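/- Let $\hat R,R_1,T_0>0$, $R>\hat R+R_1$ and $T:=T_0+R+\hat R+R_1$. Write $x=(x_1,x_2,x_3)\in\mathbb R^3$, $\tilde x=(x_1,x_2)$, $\Gamma_R=\{x\in\mathbb R^3:|x|=R\}$ and $\nu(x)=x/R$ for $x\in\Gamma_R$. Functions in $H^2(\mathbb R^d)$, $d\le 3$, are identified with their continuous representatives. Let * $J=(J_1,J_2,0)$ with $(J_1,J_2)\in H^2(\mathbb R^2)^2$ real-valued and depending only on $\tilde x$, $\operatorname{supp}J\subset\{|\tilde x|<\hat R\sqrt2/2\}$, $\nabla_{\tilde x}\cdot J=0$, and $J\in\mathcal A$, that is, for $i=1$ or for $i=2$ one has $J_i(0)>J_i(\tilde x)$ for all $\tilde x\ne 0$; * $h\in H^2(\mathbb R)$ be real-valued, not identically zero, with $\operatorname{supp}h\subset(-\hat R\sqrt2/2,\hat R\sqrt2/2)$; * $g:\mathbb R\to\mathbb R$ vanish for $t\le 0$ and for $t\ge T_0$, with $g\in C^1([0,\infty))$ and $\operatorname{supp}g=[0,T_0]$. For an orbit $\tilde a\in C^1([0,T_0];\mathbb R^2)$ with $|\tilde a(t)|\le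 R_1$ for $t\in[0,T_0]$, consider the Maxwell system $$\partial_t^2E+\nabla\times(\nabla\times E)=J(\tilde x-\tilde a(t))\,h(x_3)\,g(t)\ \text{ in }\mathbb R^3\times(0,T),\qquad E(\cdot,0)=\partial_tE(\cdot,0)=0,$$ with solutions $E\in C([0,T];H^2(\mathbb R^3))^3\cap C^2([0,T];L^2(\mathbb R^3))^3$ (the right-hand side is $0$ for $t\ge T_0$). Then, for given $J$, $h$ and $g$, the orbit is uniquely determined by the tangential trace $E\times\nu$ on $\Gamma_R\times(0,T)$: if $\tilde a,\tilde b$ are two such orbits, $E_1,E_2$ are corresponding solutions, and $E_1(x,t)\times\nu(x)=E_2(x,t)\times\nu(x)$ for all $x\in\Gamma_R$ and $t\in(0,T)$, then $\tilde a(t)=\tilde b(t)$ for all $t\in[0,T_0]$. No bound on the speed of the orbits is assumed. -/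

import Mathlib

open MeasureTheory Set
open scoped ContDiff

noncomputable section

namespace MovingSource

/-- The plane of the orbit and of the transversal variable `(x₁, x₂)`. -/
abbrev Plane : Type := EuclideanSpace ℝ (Fin 2)

/-- Three-dimensional Euclidean space. -/
abbrev Space : Type := EuclideanSpace ℝ (Fin 3)

section Sobolev

variable {V : Type*} [NormedAddCommGroup V] [NormedSpace ℝ V] [MeasureSpace V]
variable {F : Type*} [NormedAddCommGroup F] [NormedSpace ℝ F]

/-- `w` is the weak (distributional) derivative of `u` in the direction `v`:
`∫ (∂ᵥ φ) u = - ∫ φ w` for every scalar test function `φ`. -/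
def IsWeakDeriv (v : V) (u w : V → F) : Prop :=
  LocallyIntegrable u volume ∧ LocallyIntegrable w volume ∧
    ∀ φ : V → ℝ, ContDiff ℝ ∞ φ → HasCompactSupport φ →
      ∫ x, (fderiv ℝ φ x v) • u x = -∫ x, φ x • w x

/-- `u` lies in the Sobolev space `H^k = W^{k,2}`: all weak derivatives of order at most `k`
exist and are square integrable. -/
def MemH : ℕ → (V → F) → Prop
  | 0, u => MemLp u 2 volume
  | k + 1, u => MemLp u 2 volume ∧ ∀ v : V, ∃ w : V → F, IsWeakDeriv v u w ∧ MemH k w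

/-- The curve `U` lies in `C(I; H^k)`: it is a curve in `L²` all of whose weak spatial derivatives
of order at most `k` exist and depend continuously on the time `t ∈ I` in `L²`, which is continuity
for the usual norm of `H^k`. -/
def ContinuousInH : ℕ → Set ℝ → (ℝ → Lp F 2 (volume : Measure V)) → Prop
  | 0, I, U => ContinuousOn U I
  | k + 1, I, U => ContinuousOn U I ∧ ∀ v : V, ∃ W : ℝ → Lp F 2 (volume : Measure V),
      (∀ t ∈ I, IsWeakDeriv v (U t) (W t)) ∧ ContinuousInH k I W

end Sobolev

/-- The planar field `J` is divergence free in the weak sense: `∫ J · ∇φ = 0` for every test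
function `φ`. -/
def DivFree (J : Plane → Plane) : Prop :=
  ∀ φ : Plane → ℝ, ContDiff ℝ ∞ φ → HasCompactSupport φ → ∫ y, fderiv ℝ φ y (J y) = 0

/-- The partial derivative `∂ᵢ φⱼ` of a differentiable vector field on `ℝ³`. -/
def partialDeriv (φ : Space → Space) (i j : Fin 3) (x : Space) : ℝ :=
  (fderiv ℝ φ x (EuclideanSpace.single i 1)) j

/-- The classical curl `∇ × φ` of a differentiable vector field on `ℝ³`. -/
def curl (φ : Space → Space) (x : Space) : Space :=
  !₂[partialDeriv φ 1 2 x - partialDeriv φ 2 1 x,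
     partialDeriv φ 2 0 x - partialDeriv φ 0 2 x,
     partialDeriv φ 0 1 x - partialDeriv φ 1 0 x]

/-- `w = ∇ × u` in the weak (distributional) sense: `∫ w · φ = ∫ u · (∇ × φ)` for every vector
valued test function `φ`. -/
def IsWeakCurl (u w : Space → Space) : Prop :=
  LocallyIntegrable u volume ∧ LocallyIntegrable w volume ∧
    ∀ φ : Space → Space, ContDiff ℝ ∞ φ → HasCompactSupport φ →
      ∫ x, inner ℝ (w x) (φ x) = ∫ x, inner ℝ (u x) (curl φ x)

/-- `E ∈ C([0,T]; H²(ℝ³))³ ∩ C²([0,T]; L²(ℝ³))³` solves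
`∂ₜ² E + ∇ × (∇ × E) = f` in `ℝ³ × (0,T)` with `E(·,0) = ∂ₜ E(·,0) = 0`.
The function `E t` is the continuous representative of a function in `H²(ℝ³)`, so that its values
on a sphere make sense; `U` is `E` as a curve in `L²(ℝ³)³`. -/
def IsMaxwellSolution (T : ℝ) (f E : ℝ → Space → Space) : Prop :=
  (∀ t ∈ Icc 0 T, Continuous (E t)) ∧
  ∃ U : ℝ → Lp Space 2 (volume : Measure Space),
    (∀ t ∈ Icc 0 T, U t =ᵐ[volume] E t) ∧
    ContinuousInH 2 (Icc 0 T) U ∧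
    ContDiffOn ℝ 2 U (Icc 0 T) ∧
    U 0 = 0 ∧ derivWithin U (Icc 0 T) 0 = 0 ∧
    ∀ t ∈ Ioo 0 T, ∃ curlE curlcurlE : Space → Space,
      IsWeakCurl (E t) curlE ∧ IsWeakCurl curlE curlcurlE ∧
      ∀ᵐ x ∂(volume : Measure Space),
        (iteratedDerivWithin 2 U (Icc 0 T) t : Lp Space 2 (volume : Measure Space)) x
          + curlcurlE x = f t x

/-- The projection `x ↦ (x₁, x₂)` of `ℝ³` onto the plane. -/
def planePart (x : Space) : Plane := !₂[x 0, x 1]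

/-- The moving planar source `J(x̃ - a(t)) h(x₃) g(t)` at time `t`, where `J = (J₁, J₂, 0)`. -/
def source (J : Plane → Plane) (h g : ℝ → ℝ) (a : ℝ → Plane) (t : ℝ) (x : Space) : Space :=
  (h (x 2) * g t) • !₂[J (planePart x - a t) 0, J (planePart x - a t) 1, 0]

/-- The admissible class: some component of `J` has a strict global maximum at the origin. -/
def admissible : Set (Plane → Plane) :=
  {J | ∃ i : Fin 2, ∀ y : Plane, y ≠ 0 → J y i < J 0 i}

/-- The tangential trace `u × ν` at a point `x` of the sphere of radius `R` centred at the origin,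
whose unit normal is `ν(x) = x / R`. -/
def tangentialTrace (R : ℝ) (u : Space → Space) (x : Space) : Fin 3 → ℝ :=
  crossProduct (u x).ofLp (R⁻¹ • x).ofLp

end MovingSource

end

open MeasureTheory Set
open scoped ContDiff

noncomputable section

namespace MovingSource

/-! Let `e` be the difference of the two fields. It solves the Maxwell system with the difference
`f` of the two sources, with zero initial data and zero tangential trace on the sphere of radius
`R`.

Exterior. Because the tangential trace vanishes, the field cut off to `|x| > R` has as weak curl the
cut-off curl, with no surface term on the sphere (`IsWeakCurl.indicator_exterior`). It may therefore
be used as a test field. As `f` lives inside the ball, the exterior restriction of `e` satisfies a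
homogeneous second order evolution equation in symmetric weak form, and uniqueness for it
(`eq_zero_of_inner_add_inner`) gives `e = 0` outside the ball up to time `T`
(`MaxwellCurve.ae_eq_zero_exterior`).

Interior. The waves `φ(t - θ·x) p` with `|θ| = 1` and `θ·p = 0` solve the homogeneous system.
Pairing `e` with one of them leaves no term at time `0`, and none at time `T` if `φ` vanishes beyond
some `s₀ < T - R`, since the wave has then left the ball. So `f` is orthogonal to the wave in
space-time (`MaxwellCurve.integral_planeWave_eq_zero`). The sources live in `|x| ≤ r < Rhat + R₁`,
`0 ≤ t ≤ T₀`, so only the values of `φ` on `[-r, T₀ + r]` count; the choice of `T` gives `T₀ + r < T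
- R`, which leaves room to take `φ(s) = exp(l s)` there.

Transforms. With `l θ = (ξ, ζ)` the orthogonality factorizes as `L[Jᵢ](ξ) · L[h](ζ) · ∫ g (exp(-ξ·a)
- exp(-ξ·b)) exp(l t) dt = 0`, where `l² = |ξ|² + ζ²` and `L` is the two-sided Laplace transform
(`laplace_mul_laplace_mul_integral_eq_zero`). Translating the source along its orbit has become a
scalar factor at each time, so the speed plays no role. For fixed `ξ` with `L[Jᵢ](ξ) ≠ 0`, moving
`ζ` lets `l` fill an interval, and injectivity of the Laplace transform in time makes the integrand
vanish. Letting `ξ` run over an open set gives `a = b` wherever `g ≠ 0`, and these times are dense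
in `[0, T₀]`.

Since `J`, `h` and the time interval are bounded, real exponentials can replace Fourier characters,
and both injectivity statements reduce to the real Stone–Weierstrass theorem. -/

/-! ### Algebra of the classical and the weak curl. -/

/-- The antisymmetrization of a derivative that produces the curl. -/
def curlOp : (Space →L[ℝ] Space) →L[ℝ] Space :=
  LinearMap.toContinuousLinearMap
    { toFun := fun A =>
        !₂[(A (EuclideanSpace.single 1 1)) 2 - (A (EuclideanSpace.single 2 1)) 1,
          (A (EuclideanSpace.single 2 1)) 0 - (A (EuclideanSpace.single 0 1)) 2,
          (A (EuclideanSpace.single 0 1)) 1 - (A (EuclideanSpace.single 1 1)) 0]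
      map_add' := fun A B => by
        ext i; fin_cases i <;> simp <;> ring
      map_smul' := fun c A => by
        ext i; fin_cases i <;> simp <;> ring }

lemma curlOp_apply (A : Space →L[ℝ] Space) :
    curlOp A = !₂[(A (EuclideanSpace.single 1 1)) 2 - (A (EuclideanSpace.single 2 1)) 1,
          (A (EuclideanSpace.single 2 1)) 0 - (A (EuclideanSpace.single 0 1)) 2,
          (A (EuclideanSpace.single 0 1)) 1 - (A (EuclideanSpace.single 1 1)) 0] := rfl

lemma curl_eq (φ : Space → Space) (x : Space) : curl φ x = curlOp (fderiv ℝ φ x) := rfl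

/-- The cross product `ℓ × v` of a covector with a vector. -/
def covCross (l : Space →L[ℝ] ℝ) (v : Space) : Space := curlOp (l.smulRight v)

lemma covCross_apply (l : Space →L[ℝ] ℝ) (v : Space) :
    covCross l v = !₂[l (EuclideanSpace.single 1 1) * v 2 - l (EuclideanSpace.single 2 1) * v 1,
          l (EuclideanSpace.single 2 1) * v 0 - l (EuclideanSpace.single 0 1) * v 2,
          l (EuclideanSpace.single 0 1) * v 1 - l (EuclideanSpace.single 1 1) * v 0] := by
  simp [covCross, curlOp_apply]

lemma exists_norm_covCross_le : ∃ K : ℝ, 0 ≤ K ∧ ∀ (l : Space →L[ℝ] ℝ) (v : Space),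
    ‖covCross l v‖ ≤ K * (‖l‖ * ‖v‖) := by
  refine ⟨‖curlOp‖, curlOp.opNorm_nonneg, fun l v => ?_⟩
  unfold covCross
  refine (curlOp.le_opNorm _).trans ?_
  rw [ContinuousLinearMap.norm_smulRight_apply]

lemma inner_covCross (l : Space →L[ℝ] ℝ) (z v : Space) :
    inner ℝ z (covCross l v) = -inner ℝ (covCross l z) v := by
  simp only [covCross_apply, PiLp.inner_apply, Fin.sum_univ_three]
  simp
  ring

lemma continuous_covCross : Continuous fun q : (Space →L[ℝ] ℝ) × Space => covCross q.1 q.2 := by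
  unfold covCross
  have h : Continuous fun q : (Space →L[ℝ] ℝ) × Space => q.1.smulRight q.2 := by
    have := (ContinuousLinearMap.smulRightL ℝ Space Space).continuous₂
    exact this
  exact curlOp.continuous.comp h

lemma curl_smul {χ : Space → ℝ} {φ : Space → Space} {x : Space} (hχ : DifferentiableAt ℝ χ x)
    (hφ : DifferentiableAt ℝ φ x) :
    curl (fun y => χ y • φ y) x = χ x • curl φ x + covCross (fderiv ℝ χ x) (φ x) := by
  rw [curl_eq, fderiv_fun_smul hχ hφ, map_add, map_smul, curl_eq]
  rfl

lemma contDiff_curl {φ : Space → Space} (hφ : ContDiff ℝ ∞ φ) : ContDiff ℝ ∞ (curl φ) :=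
  curlOp.contDiff.comp (hφ.fderiv_right (by simp))

lemma hasCompactSupport_curl {φ : Space → Space} (hφ : HasCompactSupport φ) :
    HasCompactSupport (curl φ) :=
  (hφ.fderiv ℝ).comp_left (g := curlOp) (map_zero _)

lemma inner_curlOp_apply (A : Space →L[ℝ] Space) (v : Space) :
    inner ℝ v (curlOp A) =
      v 0 * ((A (EuclideanSpace.single 1 1)) 2 - (A (EuclideanSpace.single 2 1)) 1) +
      v 1 * ((A (EuclideanSpace.single 2 1)) 0 - (A (EuclideanSpace.single 0 1)) 2) +
      v 2 * ((A (EuclideanSpace.single 0 1)) 1 - (A (EuclideanSpace.single 1 1)) 0) := by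
  rw [curlOp_apply, PiLp.inner_apply, Fin.sum_univ_three]
  simp
  ring

lemma _root_.MeasureTheory.LocallyIntegrable.integrable_inner_of_hasCompactSupport
    {u φ : Space → Space} (hu : LocallyIntegrable u volume) (hφ : Continuous φ)
    (hc : HasCompactSupport φ) : Integrable (fun x => inner ℝ (u x) (φ x)) volume := by
  have h1 : IntegrableOn (fun x => inner ℝ (u x) (φ x)) (tsupport φ) volume := by
    obtain ⟨B, hB⟩ := hφ.bounded_above_of_compact_support hc
    have hu' := (hu.integrableOn_isCompact hc)
    refine (hu'.norm.mul_const B).mono' ?_ ?_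
    · exact hu'.aestronglyMeasurable.inner hφ.aestronglyMeasurable
    · refine Filter.Eventually.of_forall fun x => ?_
      exact (norm_inner_le_norm _ _).trans (by gcongr; exact hB x)
  refine (integrableOn_iff_integrable_of_support_subset ?_).1 h1
  intro x hx
  by_contra hx'
  exact hx (by simp [image_eq_zero_of_notMem_tsupport hx'])

namespace IsWeakCurl

variable {u w u' w' : Space → Space}

lemma sub (h : IsWeakCurl u w) (h' : IsWeakCurl u' w') :
    IsWeakCurl (fun x => u x - u' x) (fun x => w x - w' x) := by
  refine ⟨h.1.sub h'.1, h.2.1.sub h'.2.1, fun φ hφ hc => ?_⟩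
  have hc' := hasCompactSupport_curl hc
  have hφ' := (contDiff_curl hφ).continuous
  simp only [inner_sub_left]
  rw [integral_sub (h.2.1.integrable_inner_of_hasCompactSupport hφ.continuous hc)
    (h'.2.1.integrable_inner_of_hasCompactSupport hφ.continuous hc),
    integral_sub (h.1.integrable_inner_of_hasCompactSupport hφ' hc')
    (h'.1.integrable_inner_of_hasCompactSupport hφ' hc'), h.2.2 φ hφ hc, h'.2.2 φ hφ hc]

lemma congr (h : IsWeakCurl u w) (hu : u =ᵐ[volume] u') (hw : w =ᵐ[volume] w') :
    IsWeakCurl u' w' := by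
  refine ⟨?_, ?_, fun φ hφ hc => ?_⟩
  · exact (locallyIntegrable_congr hu).1 h.1
  · exact (locallyIntegrable_congr hw).1 h.2.1
  · have h1 : ∫ x, inner ℝ (w x) (φ x) = ∫ x, inner ℝ (w' x) (φ x) :=
      integral_congr_ae (hw.mono fun x hx => by simp only [hx])
    have h2 : ∫ x, inner ℝ (u x) (curl φ x) = ∫ x, inner ℝ (u' x) (curl φ x) :=
      integral_congr_ae (hu.mono fun x hx => by simp only [hx])
    rw [← h1, ← h2]
    exact h.2.2 φ hφ hc

/-- Test fields of constant direction reduce this to the fundamental lemma of the calculus of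
variations. -/
lemma unique (h : IsWeakCurl u w) (h' : IsWeakCurl u w') : w =ᵐ[volume] w' := by
  have key : ∀ᵐ x, w x - w' x = 0 := by
    refine ae_eq_zero_of_integral_contDiff_smul_eq_zero (h.2.1.sub h'.2.1) fun ψ hψ hc => ?_
    refine ext_inner_right ℝ fun q => ?_
    have hint : Integrable (fun x => ψ x • (w x - w' x)) volume :=
      (h.2.1.sub h'.2.1).integrable_smul_left_of_hasCompactSupport hψ.continuous hc
    rw [inner_zero_left, real_inner_comm, ← integral_inner hint]
    have hq : ContDiff ℝ ∞ (fun x => ψ x • q) := hψ.smul contDiff_const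
    have hqc : HasCompactSupport (fun x => ψ x • q) := hc.smul_right
    have := (h.sub h').2.2 (fun x => ψ x • q) hq hqc
    simp only [sub_self, inner_zero_left, integral_zero] at this
    rw [← this]
    congr 1 with x
    rw [real_inner_comm, real_inner_smul_left, real_inner_smul_right]
  filter_upwards [key] with x hx using sub_eq_zero.1 hx

/-- Product rule for the weak curl. -/
lemma smul {χ : Space → ℝ} (hχ : ContDiff ℝ ∞ χ) (h : IsWeakCurl u w) :
    IsWeakCurl (fun x => χ x • u x) (fun x => χ x • w x + covCross (fderiv ℝ χ x) (u x)) := by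
  have hdχ : Continuous (fderiv ℝ χ) := hχ.continuous_fderiv (by simp)
  have e1 : LocallyIntegrable (fun x => χ x • u x) volume := by
    exact h.1.continuous_smul hχ.continuous
  have e2 : LocallyIntegrable (fun x => χ x • w x) volume := by
    exact h.2.1.continuous_smul hχ.continuous
  have e3 : LocallyIntegrable (fun x => covCross (fderiv ℝ χ x) (u x)) volume := by
    have e4 : LocallyIntegrable (fun x => ‖fderiv ℝ χ x‖ • u x) volume := by
      exact h.1.continuous_smul hdχ.norm
    obtain ⟨K, hK, hKl⟩ := exists_norm_covCross_le
    have e5 : LocallyIntegrable (fun x => K • (‖fderiv ℝ χ x‖ • u x)) volume :=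
      e4.continuous_smul continuous_const
    refine e5.mono ?_ (Filter.Eventually.of_forall fun x => ?_)
    · have m : AEStronglyMeasurable (fun x => (fderiv ℝ χ x, u x)) volume :=
        hdχ.aestronglyMeasurable.prodMk h.1.aestronglyMeasurable
      exact Continuous.comp_aestronglyMeasurable (f := fun x => (fderiv ℝ χ x, u x))
        continuous_covCross m
    · refine (hKl _ _).trans ?_
      rw [norm_smul, norm_smul, norm_norm, Real.norm_of_nonneg hK]
  refine ⟨e1, e2.add e3, fun φ hφ hc => ?_⟩
  have hχφ : ContDiff ℝ ∞ (fun x => χ x • φ x) := hχ.smul hφ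
  have hχc : HasCompactSupport (fun x => χ x • φ x) :=
    hc.mono fun x hx h0 => hx (by simp only [h0, smul_zero])
  have key := h.2.2 _ hχφ hχc
  have i3 := e3.integrable_inner_of_hasCompactSupport hφ.continuous hc
  have i2 := e2.integrable_inner_of_hasCompactSupport hφ.continuous hc
  have i1 := e1.integrable_inner_of_hasCompactSupport (contDiff_curl hφ).continuous
    (hasCompactSupport_curl hc)
  simp only [inner_add_left]
  rw [integral_add i2 i3]
  have k1 : ∫ x, inner ℝ (χ x • w x) (φ x) = ∫ x, inner ℝ (w x) (χ x • φ x) := by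
    congr 1 with x; rw [real_inner_smul_left, real_inner_smul_right]
  have pt : ∀ x, inner ℝ (u x) (curl (fun y => χ y • φ y) x) =
      inner ℝ (χ x • u x) (curl φ x) - inner ℝ (covCross (fderiv ℝ χ x) (u x)) (φ x) := fun x => by
    have e : curl (fun y => χ y • φ y) x = χ x • curl φ x + covCross (fderiv ℝ χ x) (φ x) :=
      curl_smul (hχ.differentiable (by simp) x) (hφ.differentiable (by simp) x)
    rw [e, inner_add_right, inner_covCross, real_inner_smul_left, real_inner_smul_right,
      sub_eq_add_neg]
  have k2 := integral_sub i1 i3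
  rw [k1, key, integral_congr_ae (Filter.Eventually.of_forall pt), k2, sub_add_cancel]

end IsWeakCurl

/-- The weak curl assembled from the weak derivatives in the coordinate directions. -/
def curlOfPartials (W : Fin 3 → Space) : Space :=
  !₂[W 1 2 - W 2 1, W 2 0 - W 0 2, W 0 1 - W 1 0]

/-- Scalar test functions `φ j` give integration by parts for every component of every partial
derivative; the curl identity is a signed sum of six of these. The curl is prescribed only almost
everywhere, so that an `Lp` representative can be used. -/
lemma isWeakCurl_of_isWeakDeriv {u : Space → Space} {W : Fin 3 → Space → Space}
    (h : ∀ i, IsWeakDeriv (EuclideanSpace.single i (1 : ℝ)) u (W i)) {c : Space → Space}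
    (hcl : LocallyIntegrable c volume)
    (hc : ∀ᵐ x, c x = curlOfPartials fun i => W i x) :
    IsWeakCurl u c := by
  refine ⟨(h 0).1, hcl, fun φ hφ hφc => ?_⟩
  -- the integrated form of the weak derivative, component by component
  have hcoord : ∀ j : Fin 3, ContDiff ℝ ∞ fun x => φ x j := fun j =>
    (EuclideanSpace.proj (𝕜 := ℝ) j : Space →L[ℝ] ℝ).contDiff.comp hφ
  have hcoordc : ∀ j : Fin 3, HasCompactSupport fun x => φ x j := fun j =>
    hφc.comp_left (g := fun v : Space => v j) rfl
  have hder : ∀ i j : Fin 3, ∀ x, fderiv ℝ (fun x => φ x j) x (EuclideanSpace.single i 1)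
      = (fderiv ℝ φ x (EuclideanSpace.single i 1)) j := fun i j x => by
    have := ((EuclideanSpace.proj (𝕜 := ℝ) j : Space →L[ℝ] ℝ).hasFDerivAt.comp x
      (hφ.differentiable (by simp) x).hasFDerivAt).fderiv
    have h2 : (⇑(EuclideanSpace.proj (𝕜 := ℝ) j : Space →L[ℝ] ℝ) ∘ φ) = fun x => φ x j := rfl
    rw [h2] at this
    rw [this]; rfl
  have iW : ∀ i j k : Fin 3, Integrable (fun x => φ x j * W i x k) volume := fun i j k => by
    have := (h i).2.1.integrable_smul_left_of_hasCompactSupport (hcoord j).continuous (hcoordc j)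
    exact (EuclideanSpace.proj (𝕜 := ℝ) k : Space →L[ℝ] ℝ).integrable_comp this
  have hd : ∀ i j : Fin 3, Continuous fun x => (fderiv ℝ φ x (EuclideanSpace.single i 1)) j := by
    intro i j
    have := hφ.continuous_fderiv (by simp)
    fun_prop
  have hdc : ∀ i j : Fin 3,
      HasCompactSupport fun x => (fderiv ℝ φ x (EuclideanSpace.single i 1)) j := fun i j =>
    (hφc.fderiv ℝ).comp_left (g := fun A : Space →L[ℝ] Space => (A (EuclideanSpace.single i 1)) j)
      rfl
  have iu : ∀ i j k : Fin 3,
      Integrable (fun x => (fderiv ℝ φ x (EuclideanSpace.single i 1)) j * u x k) volume :=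
    fun i j k => by
    have := (h i).1.integrable_smul_left_of_hasCompactSupport (hd i j) (hdc i j)
    exact (EuclideanSpace.proj (𝕜 := ℝ) k : Space →L[ℝ] ℝ).integrable_comp this
  have key : ∀ i j k : Fin 3, ∫ x, (fderiv ℝ φ x (EuclideanSpace.single i 1)) j * u x k
      = -∫ x, φ x j * W i x k := fun i j k => by
    have h0 := (h i).2.2 _ (hcoord j) (hcoordc j)
    simp only [hder] at h0
    have h1 := congrArg (EuclideanSpace.proj (𝕜 := ℝ) k : Space →L[ℝ] ℝ) h0
    rw [map_neg, ← ContinuousLinearMap.integral_comp_comm, ← ContinuousLinearMap.integral_comp_comm]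
      at h1
    · exact h1
    · exact (h i).2.1.integrable_smul_left_of_hasCompactSupport (hcoord j).continuous (hcoordc j)
    · exact (h i).1.integrable_smul_left_of_hasCompactSupport (hd i j) (hdc i j)
  have hl : ∫ x, inner ℝ (c x) (φ x) =
      ∫ x, ((φ x 0 * W 1 x 2 - φ x 0 * W 2 x 1) + (φ x 1 * W 2 x 0 - φ x 1 * W 0 x 2)) +
        (φ x 2 * W 0 x 1 - φ x 2 * W 1 x 0) := by
    refine integral_congr_ae (hc.mono fun x hx => ?_)
    simp only [hx, curlOfPartials, PiLp.inner_apply, Fin.sum_univ_three]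
    simp
    ring
  have hr : ∫ x, inner ℝ (u x) (curl φ x) =
      ∫ x, (((fderiv ℝ φ x (EuclideanSpace.single 1 1)) 2 * u x 0
          - (fderiv ℝ φ x (EuclideanSpace.single 2 1)) 1 * u x 0) +
        ((fderiv ℝ φ x (EuclideanSpace.single 2 1)) 0 * u x 1
          - (fderiv ℝ φ x (EuclideanSpace.single 0 1)) 2 * u x 1)) +
        ((fderiv ℝ φ x (EuclideanSpace.single 0 1)) 1 * u x 2
          - (fderiv ℝ φ x (EuclideanSpace.single 1 1)) 0 * u x 2) := by
    congr 1 with x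
    rw [curl_eq, inner_curlOp_apply]
    ring
  rw [hl, hr]
  rw [integral_add, integral_add, integral_sub, integral_sub, integral_sub,
    integral_add, integral_add, integral_sub, integral_sub, integral_sub]
  · simp only [key]; ring
  all_goals
    first
    | exact iW _ _ _
    | exact iu _ _ _
    | exact (iW _ _ _).sub (iW _ _ _)
    | exact (iu _ _ _).sub (iu _ _ _)
    | exact ((iW _ _ _).sub (iW _ _ _)).add ((iW _ _ _).sub (iW _ _ _))
    | exact ((iu _ _ _).sub (iu _ _ _)).add ((iu _ _ _).sub (iu _ _ _))

/-- A curve in `C(I; H²)` has a continuous curve of weak curls in `L²`. -/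
lemma ContinuousInH.exists_weakCurl {I : Set ℝ} {U : ℝ → Lp Space 2 (volume : Measure Space)}
    {k : ℕ} (h : ContinuousInH (k + 1) I U) :
    ∃ C : ℝ → Lp Space 2 (volume : Measure Space), ContinuousOn C I ∧
      ∀ t ∈ I, IsWeakCurl (U t) (C t) := by
  choose W hW hWc using fun i : Fin 3 => h.2 (EuclideanSpace.single i (1 : ℝ))
  have hcont : ∀ i, ContinuousOn (W i) I := fun i => by
    cases k with
    | zero => exact hWc i
    | succ k => exact (hWc i).1
  -- `L i` is the contribution of the `i`-th partial derivative to the curl. As a bounded operator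
  -- it acts on `L²`, so continuity in time passes from the partial derivatives to the curl.
  let L : Fin 3 → Space →L[ℝ] Space := fun i => LinearMap.toContinuousLinearMap
    { toFun := fun v => curlOfPartials (fun j => if j = i then v else 0)
      map_add' := fun v v' => by
        ext j; fin_cases i <;> fin_cases j <;> simp [curlOfPartials] <;> ring
      map_smul' := fun r v => by
        ext j; fin_cases i <;> fin_cases j <;> simp [curlOfPartials] }
  have hL : ∀ (w : Fin 3 → Space), L 0 (w 0) + L 1 (w 1) + L 2 (w 2) = curlOfPartials w := by
    intro w
    ext j
    fin_cases j <;> simp [L, curlOfPartials] <;> ring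
  refine ⟨fun t => (L 0).compLpL 2 volume (W 0 t) + (L 1).compLpL 2 volume (W 1 t)
    + (L 2).compLpL 2 volume (W 2 t), ?_, fun t ht => ?_⟩
  · exact (((ContinuousLinearMap.continuous _).comp_continuousOn (hcont 0)).add
      ((ContinuousLinearMap.continuous _).comp_continuousOn (hcont 1))).add
      ((ContinuousLinearMap.continuous _).comp_continuousOn (hcont 2))
  · refine isWeakCurl_of_isWeakDeriv (fun i => hW i t ht)
      ((Lp.memLp _).locallyIntegrable (by norm_num)) ?_
    filter_upwards [(L 0).coeFn_compLpL (W 0 t), (L 1).coeFn_compLpL (W 1 t),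
      (L 2).coeFn_compLpL (W 2 t),
      Lp.coeFn_add ((L 0).compLpL 2 volume (W 0 t) + (L 1).compLpL 2 volume (W 1 t))
        ((L 2).compLpL 2 volume (W 2 t)),
      Lp.coeFn_add ((L 0).compLpL 2 volume (W 0 t)) ((L 1).compLpL 2 volume (W 1 t))]
      with x h0 h1 h2 h3 h4
    rw [h3, Pi.add_apply, h4, Pi.add_apply, h0, h1, h2, ← hL]

/-! ### Correlations in `L²`, mollification, and symmetry of the weak curl. -/

lemma _root_.MeasureTheory.MemLp.comp_sub {H : Type*} [NormedAddCommGroup H] {f : Space → H}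
    (hf : MemLp f 2 volume) (y : Space) : MemLp (fun x => f (x - y)) 2 volume :=
  hf.comp_measurePreserving (measurePreserving_sub_right volume y)

section Translation

variable {H : Type*} [NormedAddCommGroup H] [InnerProductSpace ℝ H]

lemma _root_.MeasureTheory.MemLp.integrable_inner' {X : Type*} [MeasurableSpace X] {μ : Measure X}
    {f g : X → H} (hf : MemLp f 2 μ) (hg : MemLp g 2 μ) :
    Integrable (fun x => inner ℝ (f x) (g x)) μ := by
  have := L2.integrable_inner (𝕜 := ℝ) (hf.toLp f) (hg.toLp g)
  refine this.congr ?_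
  filter_upwards [hf.coeFn_toLp, hg.coeFn_toLp] with x h1 h2
  rw [h1, h2]

lemma inner_toLp' {X : Type*} [MeasurableSpace X] {μ : Measure X}
    {f g : X → H} (hf : MemLp f 2 μ) (hg : MemLp g 2 μ) :
    inner ℝ (hf.toLp f) (hg.toLp g) = ∫ x, inner ℝ (f x) (g x) ∂μ := by
  rw [L2.inner_def]
  refine integral_congr_ae ?_
  filter_upwards [hf.coeFn_toLp, hg.coeFn_toLp] with x h1 h2
  rw [h1, h2]

/-- The cross-correlation of two square integrable functions is continuous. -/
lemma continuous_integral_inner_translate {f g : Space → H} (hf : MemLp f 2 volume)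
    (hg : MemLp g 2 volume) : Continuous fun y => ∫ x, inner ℝ (f x) (g (x - y)) := by
  -- Translations act strongly continuously on `L²`; the action composes with `x ↦ c + x`, whence
  -- the sign of `y`.
  have h1 : Continuous fun y : Space => inner ℝ (hf.toLp f)
      ((DomAddAct.mk (-y) : Spaceᵈᵃᵃ) +ᵥ hg.toLp g) := by
    have : Fact ((2 : ENNReal) ≠ ⊤) := ⟨by norm_num⟩
    exact continuous_const.inner
      (((DomAddAct.continuous_mk.comp continuous_neg)).vadd continuous_const)
  refine h1.congr fun y => ?_
  rw [DomAddAct.mk_vadd_toLp, inner_toLp' hf _]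
  simp only [vadd_eq_add, neg_add_eq_sub]

/-- This is Fubini. It turns an average of correlations over `y` into the pairing with a mollified
function. -/
lemma integral_smul_inner_translate [CompleteSpace H] {f g : Space → H} (hf : MemLp f 2 volume)
    (hg : MemLp g 2 volume) {ρ : Space → ℝ} (hρ : Continuous ρ) (hρc : HasCompactSupport ρ) :
    ∫ y, ρ y * ∫ x, inner ℝ (f x) (g (x - y)) = ∫ x, inner ℝ (f x) (∫ y, ρ y • g (x - y)) := by
  have hm : AEStronglyMeasurable
      (fun q : Space × Space => ρ q.2 * inner ℝ (f q.1) (g (q.1 - q.2)))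
      (volume.prod volume) := by
    refine AEStronglyMeasurable.mul (hρ.comp continuous_snd).aestronglyMeasurable ?_
    refine AEStronglyMeasurable.inner hf.1.comp_fst ?_
    exact hg.1.comp_quasiMeasurePreserving
      (quasiMeasurePreserving_sub_of_right_invariant volume volume)
  have hint : Integrable (fun q : Space × Space => ρ q.2 * inner ℝ (f q.1) (g (q.1 - q.2)))
      (volume.prod volume) := by
    refine (integrable_prod_iff' hm).2 ⟨Filter.Eventually.of_forall fun y => ?_, ?_⟩
    · exact (hf.integrable_inner' (hg.comp_sub y)).const_mul (ρ y)
    -- The iterated integral of the norm is dominated by `|ρ|` times the correlation of `‖f‖` and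
    -- `‖g‖`, which is continuous, and `ρ` has compact support.
    · have hc := continuous_integral_inner_translate hf.norm hg.norm
      have h2 : Integrable (fun y => ‖ρ y‖ * ∫ x, inner ℝ ‖f x‖ ‖g (x - y)‖) volume :=
        (hρ.norm.mul hc).integrable_of_hasCompactSupport
          hρc.norm.mul_right
      refine h2.mono' hm.norm.prod_swap.integral_prod_right' (Filter.Eventually.of_forall fun y => ?_)
      rw [Real.norm_of_nonneg (integral_nonneg fun _ => norm_nonneg _)]
      simp only [norm_mul]
      rw [integral_const_mul]
      refine mul_le_mul_of_nonneg_left ?_ (norm_nonneg _)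
      refine integral_mono (hf.integrable_inner' (hg.comp_sub y)).norm
        (hf.norm.integrable_inner' (hg.norm.comp_sub y)) fun x => ?_
      refine (norm_inner_le_norm _ _).trans (le_of_eq ?_)
      simp [mul_comm]
  simp only [← integral_const_mul]
  rw [← integral_integral_swap (f := fun x y => ρ y * inner ℝ (f x) (g (x - y))) hint]
  congr 1 with x
  rw [← integral_inner]
  · simp only [real_inner_smul_right]
  · have hl : LocallyIntegrable g volume := hg.locallyIntegrable (by norm_num)
    exact hρc.convolutionExists_left (ContinuousLinearMap.lsmul ℝ ℝ) hρ hl x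

end Translation

/-- Mollification commutes with the weak curl. -/
lemma IsWeakCurl.curl_mollify {z cz : Space → Space} (h : IsWeakCurl z cz) {ρ : Space → ℝ}
    (hρ : ContDiff ℝ ∞ ρ) (hρc : HasCompactSupport ρ) (x : Space) :
    curl (fun x => ∫ y, ρ y • z (x - y)) x = ∫ y, ρ y • cz (x - y) := by
  have hd : ContDiff ℝ 1 ρ := hρ.of_le (by simp)
  have h1 := (hρc.hasFDerivAt_convolution_left (ContinuousLinearMap.lsmul ℝ ℝ) hd h.1 x).fderiv
  have h2 : convolution ρ z (ContinuousLinearMap.lsmul ℝ ℝ) volume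
      = fun x => ∫ y, ρ y • z (x - y) := rfl
  rw [h2] at h1
  have hex := (hρc.fderiv ℝ).convolutionExists_left
    ((ContinuousLinearMap.lsmul ℝ ℝ : ℝ →L[ℝ] Space →L[ℝ] Space).precompL Space)
    (hd.continuous_fderiv (by simp)) h.1 x
  have h3 : ∀ y, curlOp ((ContinuousLinearMap.lsmul ℝ ℝ : ℝ →L[ℝ] Space →L[ℝ] Space).precompL Space
      (fderiv ℝ ρ y) (z (x - y))) = covCross (fderiv ℝ ρ y) (z (x - y)) := fun y => by
    unfold covCross
    congr 1
  have hint : Integrable (fun y => covCross (fderiv ℝ ρ y) (z (x - y))) volume := by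
    simp only [← h3]
    exact curlOp.integrable_comp hex
  have h4 : curl (fun x => ∫ y, ρ y • z (x - y)) x
      = ∫ y, covCross (fderiv ℝ ρ y) (z (x - y)) := by
    rw [curl_eq, h1, convolution_def, ← ContinuousLinearMap.integral_comp_comm _ hex]
    simp only [h3]
  have hint2 : Integrable (fun y => ρ y • cz (x - y)) volume :=
    hρc.convolutionExists_left (ContinuousLinearMap.lsmul ℝ ℝ) hd.continuous h.2.1 x
  rw [h4]
  refine ext_inner_right ℝ fun q => ?_
  rw [real_inner_comm, ← integral_inner hint, real_inner_comm, ← integral_inner hint2]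
  have hsub : ContDiff ℝ ∞ fun y : Space => ρ (x - y) := hρ.comp (contDiff_const.sub contDiff_id)
  have hsubc : HasCompactSupport fun y : Space => ρ (x - y) :=
    hρc.comp_homeomorph (Homeomorph.subLeft x)
  have hfd : ∀ y, fderiv ℝ (fun y => ρ (x - y)) y = -fderiv ℝ ρ (x - y) := fun y => by
    have e1 : HasFDerivAt (fun y : Space => x - y) (-(ContinuousLinearMap.id ℝ Space)) y := by
      simpa using (hasFDerivAt_id y).const_sub x
    have e2 := ((hd.differentiable (by simp) (x - y)).hasFDerivAt.comp y e1).fderiv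
    have e3 : (ρ ∘ fun y => x - y) = fun y => ρ (x - y) := rfl
    rw [e3] at e2
    rw [e2]
    ext v
    simp
  have key := h.2.2 (fun y => ρ (x - y) • q) (hsub.smul contDiff_const) hsubc.smul_right
  have e1 : ∫ y, inner ℝ q (ρ y • cz (x - y)) = ∫ y, inner ℝ (cz y) (ρ (x - y) • q) := by
    rw [← integral_sub_left_eq_self _ volume x]
    congr 1 with y
    rw [sub_sub_cancel, real_inner_smul_right, real_inner_smul_right, real_inner_comm]
  have e2 : ∫ y, inner ℝ q (covCross (fderiv ℝ ρ y) (z (x - y))) =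
      ∫ y, inner ℝ (z y) (curl (fun y => ρ (x - y) • q) y) := by
    rw [← integral_sub_left_eq_self _ volume x]
    congr 1 with y
    have e3 : curl (fun y => ρ (x - y) • q) y = ρ (x - y) • curl (fun _ => q) y
        + covCross (fderiv ℝ (fun y => ρ (x - y)) y) q :=
      curl_smul (hsub.differentiable (by simp) y) (differentiableAt_const q)
    have e4 : curl (fun _ => q) y = 0 := by
      rw [curl_eq, fderiv_fun_const]; exact map_zero _
    rw [e3, e4, smul_zero, zero_add, hfd, sub_sub_cancel]
    have e5 : covCross (-fderiv ℝ ρ (x - y)) (z y) = -covCross (fderiv ℝ ρ (x - y)) (z y) := by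
      rw [covCross_apply, covCross_apply]
      ext i; fin_cases i <;> simp <;> ring
    rw [inner_covCross (-fderiv ℝ ρ (x - y)), e5, inner_neg_left, neg_neg, real_inner_comm]
  rw [e1, e2, key]

lemma contDiff_mollify {z : Space → Space} (hz : LocallyIntegrable z volume) {ρ : Space → ℝ}
    (hρ : ContDiff ℝ ∞ ρ) (hρc : HasCompactSupport ρ) :
    ContDiff ℝ ∞ fun x => ∫ y, ρ y • z (x - y) :=
  hρc.contDiff_convolution_left (ContinuousLinearMap.lsmul ℝ ℝ) hρ hz

lemma hasCompactSupport_mollify {z : Space → Space} (hz : HasCompactSupport z) {ρ : Space → ℝ}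
    (hρc : HasCompactSupport ρ) : HasCompactSupport fun x => ∫ y, ρ y • z (x - y) :=
  hρc.convolution (ContinuousLinearMap.lsmul ℝ ℝ) hz

/-- Symmetry of the curl on `L²` when one of the fields has compact support. -/
lemma integral_inner_weakCurl_comm_of_hasCompactSupport {z cz w cw : Space → Space}
    (hz : MemLp z 2 volume) (hcz : MemLp cz 2 volume) (hw : MemLp w 2 volume)
    (hcw : MemLp cw 2 volume) (hzc : HasCompactSupport z)
    (h : IsWeakCurl z cz) (h' : IsWeakCurl w cw) :
    ∫ x, inner ℝ (cw x) (z x) = ∫ x, inner ℝ (w x) (cz x) := by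
  -- The identity is proved for all translates of `z` at once. The defect is a continuous function
  -- of the shift `y`; its integral against any test function `ρ` vanishes, because mollifying `z`
  -- by `ρ` produces a legitimate test field for the weak curl of `w`. So the defect is identically
  -- zero, and `y = 0` is the claim. No convergence of mollifiers is needed.
  have c1 := continuous_integral_inner_translate hcw hz
  have c2 := continuous_integral_inner_translate hw hcz
  have hB := c1.sub c2
  have hae : ∀ᵐ y, (∫ x, inner ℝ (cw x) (z (x - y))) - ∫ x, inner ℝ (w x) (cz (x - y)) = 0 := by
    refine ae_eq_zero_of_integral_contDiff_smul_eq_zero hB.locallyIntegrable fun ρ hρ hρc => ?_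
    have i1 : Integrable (fun y => ρ y * ∫ x, inner ℝ (cw x) (z (x - y))) volume :=
      (hρ.continuous.mul c1).integrable_of_hasCompactSupport hρc.mul_right
    have i2 : Integrable (fun y => ρ y * ∫ x, inner ℝ (w x) (cz (x - y))) volume :=
      (hρ.continuous.mul c2).integrable_of_hasCompactSupport hρc.mul_right
    simp only [smul_eq_mul, mul_sub]
    rw [integral_sub i1 i2, integral_smul_inner_translate hcw hz hρ.continuous hρc,
      integral_smul_inner_translate hw hcz hρ.continuous hρc,
      h'.2.2 _ (contDiff_mollify h.1 hρ hρc) (hasCompactSupport_mollify hzc hρc)]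
    simp only [h.curl_mollify hρ hρc, sub_self]
  have := (hB.ae_eq_iff_eq volume continuous_const).1 hae
  simpa only [Pi.sub_apply, sub_zero, sub_eq_zero] using congrFun this 0

lemma covCross_smul (r : ℝ) (l : Space →L[ℝ] ℝ) (v : Space) :
    covCross (r • l) v = r • covCross l v := by
  simp only [covCross_apply]
  ext i; fin_cases i <;> simp <;> ring

/-- Symmetry of the curl on its maximal domain in `L²`. -/
lemma integral_inner_weakCurl_comm {z cz w cw : Space → Space}
    (hz : MemLp z 2 volume) (hcz : MemLp cz 2 volume) (hw : MemLp w 2 volume)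
    (hcw : MemLp cw 2 volume) (h : IsWeakCurl z cz) (h' : IsWeakCurl w cw) :
    ∫ x, inner ℝ (cw x) (z x) = ∫ x, inner ℝ (w x) (cz x) := by
  obtain ⟨K, hK, hKl⟩ := exists_norm_covCross_le
  let χ : ContDiffBump (0 : Space) := ⟨1, 2, one_pos, one_lt_two⟩
  have hχ : ContDiff ℝ ∞ χ := χ.contDiff
  have hχd : Differentiable ℝ χ := hχ.differentiable (by simp)
  obtain ⟨M, hM⟩ := (hχ.continuous_fderiv (by simp)).bounded_above_of_compact_support
    (χ.hasCompactSupport.fderiv ℝ)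
  have hM0 : 0 ≤ M := (norm_nonneg _).trans (hM 0)
  let r : ℕ → ℝ := fun n => ((n : ℝ) + 1)⁻¹
  have hr : ∀ n, 0 < r n := fun n => by positivity
  have hr1 : ∀ n, r n ≤ 1 := fun n => inv_le_one_of_one_le₀ (by linarith [n.cast_nonneg (α := ℝ)])
  have hrt : Filter.Tendsto r Filter.atTop (nhds 0) := by
    simpa [r, one_div] using tendsto_one_div_add_atTop_nhds_zero_nat (𝕜 := ℝ)
  -- The cutoffs at scale `1 / r n` have gradients of size `O(r n)`, so the commutator with the curl
  -- disappears in the limit.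
  let X : ℕ → Space → ℝ := fun n x => χ (r n • x)
  have hX : ∀ n, ContDiff ℝ ∞ (X n) := fun n => hχ.comp (contDiff_const_smul (r n))
  have hXc : ∀ n, HasCompactSupport (X n) := fun n =>
    χ.hasCompactSupport.comp_smul (hr n).ne'
  have hXd : ∀ n x, fderiv ℝ (X n) x = r n • fderiv ℝ χ (r n • x) := fun n x => by
    have e1 : HasFDerivAt (fun y : Space => r n • y) (r n • ContinuousLinearMap.id ℝ Space) x :=
      (hasFDerivAt_id x).const_smul (r n)
    have e2 := ((hχd (r n • x)).hasFDerivAt.comp x e1).fderiv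
    have e3 : (χ ∘ fun y => r n • y) = X n := rfl
    rw [e3] at e2
    rw [e2]
    ext v
    simp
  have hXdn : ∀ n x, ‖covCross (fderiv ℝ (X n) x) (z x)‖ ≤ r n * (K * (M * ‖z x‖)) := fun n x => by
    rw [hXd, covCross_smul, norm_smul, Real.norm_of_nonneg (hr n).le]
    refine mul_le_mul_of_nonneg_left ((hKl _ _).trans ?_) (hr n).le
    have := hM (r n • x)
    gcongr
  have hX1 : ∀ n x, |X n x| ≤ 1 := fun n x => by
    rw [abs_of_nonneg χ.nonneg]; exact χ.le_one
  have hXlim : ∀ x, Filter.Tendsto (fun n => X n x) Filter.atTop (nhds 1) := fun x => by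
    have h1 : Filter.Tendsto (fun n => r n • x) Filter.atTop (nhds ((0 : ℝ) • x)) :=
      hrt.smul_const x
    have h2 := (hχ.continuous.tendsto ((0 : ℝ) • x)).comp h1
    have h3 : χ ((0 : ℝ) • x) = 1 := by
      rw [zero_smul]; exact χ.one_of_mem_closedBall (by simp [χ])
    rwa [h3] at h2
  have hbd : ∀ n x, ‖X n x • cz x + covCross (fderiv ℝ (X n) x) (z x)‖
      ≤ ‖cz x‖ + K * (M * ‖z x‖) := fun n x => by
    refine (norm_add_le _ _).trans (add_le_add ?_ ((hXdn n x).trans ?_))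
    · rw [norm_smul, Real.norm_eq_abs]
      exact mul_le_of_le_one_left (norm_nonneg _) (hX1 n x)
    · exact mul_le_of_le_one_left (by positivity) (hr1 n)
  have hbL : MemLp (fun x => ‖cz x‖ + K * (M * ‖z x‖)) 2 volume :=
    hcz.norm.add ((hz.norm.const_mul M).const_mul K)
  have hn : ∀ n, ∫ x, inner ℝ (cw x) (X n x • z x)
      = ∫ x, inner ℝ (w x) (X n x • cz x + covCross (fderiv ℝ (X n) x) (z x)) := fun n => by
    have hs := h.smul (hX n)
    refine integral_inner_weakCurl_comm_of_hasCompactSupport ?_ ?_ hw hcw ?_ hs h'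
    · refine hz.of_le hs.1.aestronglyMeasurable (Filter.Eventually.of_forall fun x => ?_)
      rw [norm_smul, Real.norm_eq_abs]
      exact mul_le_of_le_one_left (norm_nonneg _) (hX1 n x)
    · refine hbL.of_le hs.2.1.aestronglyMeasurable (Filter.Eventually.of_forall fun x => ?_)
      exact (hbd n x).trans (le_abs_self _)
    · exact (hXc n).mono fun x hx h0 => hx (by simp only [h0, zero_smul])
  have t1 : Filter.Tendsto (fun n => ∫ x, inner ℝ (cw x) (X n x • z x)) Filter.atTop
      (nhds (∫ x, inner ℝ (cw x) (z x))) := by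
    refine tendsto_integral_of_dominated_convergence (fun x => ‖cw x‖ * ‖z x‖) (fun n => ?_) ?_
      (fun n => ?_) ?_
    · exact hcw.1.inner (h.smul (hX n)).1.aestronglyMeasurable
    · exact hcw.norm.integrable_mul hz.norm
    · refine Filter.Eventually.of_forall fun x => (norm_inner_le_norm _ _).trans ?_
      rw [norm_smul, Real.norm_eq_abs]
      exact mul_le_mul_of_nonneg_left (mul_le_of_le_one_left (norm_nonneg _) (hX1 n x))
        (norm_nonneg _)
    · refine Filter.Eventually.of_forall fun x => ?_
      have : Filter.Tendsto (fun n => X n x * inner ℝ (cw x) (z x)) Filter.atTop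
          (nhds (1 * inner ℝ (cw x) (z x))) := (hXlim x).mul_const _
      simpa only [real_inner_smul_right, one_mul] using this
  have t2 : Filter.Tendsto (fun n => ∫ x, inner ℝ (w x)
      (X n x • cz x + covCross (fderiv ℝ (X n) x) (z x))) Filter.atTop
      (nhds (∫ x, inner ℝ (w x) (cz x))) := by
    refine tendsto_integral_of_dominated_convergence
      (fun x => ‖w x‖ * (‖cz x‖ + K * (M * ‖z x‖))) (fun n => ?_) ?_ (fun n => ?_) ?_
    · exact hw.1.inner (h.smul (hX n)).2.1.aestronglyMeasurable
    · exact hw.norm.integrable_mul hbL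
    · refine Filter.Eventually.of_forall fun x => (norm_inner_le_norm _ _).trans ?_
      exact mul_le_mul_of_nonneg_left (hbd n x) (norm_nonneg _)
    · refine Filter.Eventually.of_forall fun x => ?_
      have a1 : Filter.Tendsto (fun n => X n x • cz x) Filter.atTop (nhds ((1 : ℝ) • cz x)) :=
        (hXlim x).smul_const _
      have a2 : Filter.Tendsto (fun n => covCross (fderiv ℝ (X n) x) (z x)) Filter.atTop
          (nhds 0) := by
        refine squeeze_zero_norm (fun n => hXdn n x) ?_
        simpa using hrt.mul_const (K * (M * ‖z x‖))
      have a3 := a1.add a2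
      rw [one_smul, add_zero] at a3
      exact tendsto_const_nhds.inner a3
  exact tendsto_nhds_unique t1 (t2.congr fun n => (hn n).symm)

/-! ### Extension by zero across a sphere. -/

lemma exists_abs_deriv_smoothTransition_le : ∃ C : ℝ, 0 ≤ C ∧
    ∀ s, |deriv Real.smoothTransition s| ≤ C ∧
      (s ∉ Icc (0 : ℝ) 1 → deriv Real.smoothTransition s = 0) := by
  have h0 : ∀ s, s ∉ Icc (0 : ℝ) 1 → deriv Real.smoothTransition s = 0 := by
    intro s hs
    rw [mem_Icc, not_and_or, not_le, not_le] at hs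
    rcases hs with hs | hs
    · have : Real.smoothTransition =ᶠ[nhds s] fun _ => 0 := by
        filter_upwards [Iio_mem_nhds hs] with y hy
        exact Real.smoothTransition.zero_of_nonpos (le_of_lt hy)
      rw [this.deriv_eq, deriv_const]
    · have : Real.smoothTransition =ᶠ[nhds s] fun _ => 1 := by
        filter_upwards [Ioi_mem_nhds hs] with y hy
        exact Real.smoothTransition.one_of_one_le (le_of_lt hy)
      rw [this.deriv_eq, deriv_const]
  have hc : Continuous (deriv Real.smoothTransition) :=
    (Real.smoothTransition.contDiff (n := 1)).continuous_deriv (by simp)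
  obtain ⟨C, hC⟩ := hc.bounded_above_of_compact_support
    (HasCompactSupport.intro (isCompact_Icc (a := (0 : ℝ)) (b := 1)) h0)
  exact ⟨C, (norm_nonneg _).trans (hC 0), fun s => ⟨hC s, h0 s⟩⟩

/-- A continuous field is uniformly small near a sphere on which it vanishes. -/
lemma exists_norm_le_near_sphere {R : ℝ} (hR : 0 < R) {τ : Space → Space} (hτ : Continuous τ)
    (h0 : ∀ x, ‖x‖ = R → τ x = 0) {ε : ℝ} (hε : 0 < ε) :
    ∃ δ > 0, ∀ x, R ≤ ‖x‖ → ‖x‖ < R + δ → ‖τ x‖ ≤ ε := by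
  have hu := (isCompact_closedBall (0 : Space) (R + 1)).uniformContinuousOn_of_continuous
    hτ.continuousOn
  obtain ⟨δ, hδ, hd⟩ := Metric.uniformContinuousOn_iff.1 hu ε hε
  refine ⟨min δ 1, lt_min hδ one_pos, fun x hx1 hx2 => ?_⟩
  have hxp : 0 < ‖x‖ := hR.trans_le hx1
  -- The radial projection of `x` onto the sphere, where the field vanishes, is the point to compare
  -- with.
  have hn : ‖(R / ‖x‖) • x‖ = R := by
    rw [norm_smul, Real.norm_of_nonneg (by positivity)]; field_simp
  have hdist : dist x ((R / ‖x‖) • x) < δ := by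
    have : x - (R / ‖x‖) • x = (1 - R / ‖x‖) • x := by rw [sub_smul, one_smul]
    rw [dist_eq_norm, this, norm_smul, Real.norm_of_nonneg
      (sub_nonneg.2 ((div_le_one hxp).2 hx1)), sub_mul, one_mul, div_mul_cancel₀ _ hxp.ne']
    linarith [min_le_left δ 1]
  have := hd x (by simp; linarith [min_le_right δ 1]) _ (by simp only [mem_closedBall_zero_iff, hn]; linarith) hdist
  rw [h0 _ hn, dist_zero_right] at this
  exact this.le

lemma volume_shell_le {R : ℝ} (hR : 0 < R) : ∃ B : ℝ, 0 ≤ B ∧ ∀ δ, 0 ≤ δ → δ ≤ 1 →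
    volume.real (Metric.closedBall (0 : Space) (R + δ) \ Metric.ball 0 R) ≤ B * δ := by
  let v : ℝ := volume.real (Metric.ball (0 : Space) 1)
  -- From `(R + δ)³ - R³ = 3R²δ + 3Rδ² + δ³` with `δ², δ³ ≤ δ`.
  refine ⟨(3 * R ^ 2 + 3 * R + 1) * v, by positivity, fun δ h0 h1 => ?_⟩
  have hs : Metric.ball (0 : Space) R ⊆ Metric.closedBall 0 (R + δ) :=
    Metric.ball_subset_closedBall.trans (Metric.closedBall_subset_closedBall (by linarith))
  rw [measureReal_sdiff hs Metric.isOpen_ball.measurableSet measure_closedBall_lt_top.ne,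
    Measure.addHaar_real_closedBall _ _ (by linarith),
    ← Measure.addHaar_real_closedBall_eq_addHaar_real_ball _ _ R,
    Measure.addHaar_real_closedBall _ _ hR.le]
  have hf : Module.finrank ℝ Space = 3 := by simp
  rw [hf]
  have hv : 0 ≤ v := measureReal_nonneg
  have : (R + δ) ^ 3 - R ^ 3 ≤ (3 * R ^ 2 + 3 * R + 1) * δ := by
    have : δ * δ ≤ δ := mul_le_of_le_one_left h0 h1
    have h3 : δ * δ * δ ≤ δ := (mul_le_of_le_one_right (by positivity) h1).trans this
    nlinarith
  change (R + δ) ^ 3 * v - R ^ 3 * v ≤ _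
  nlinarith

/-- Smooth functions that vanish in the ball of radius `R` and converge to the indicator function
of its exterior. -/
def exteriorCutoff (R : ℝ) (n : ℕ) (x : Space) : ℝ :=
  Real.smoothTransition (n * (‖x‖ ^ 2 - R ^ 2))

lemma contDiff_exteriorCutoff (R : ℝ) (n : ℕ) : ContDiff ℝ ∞ (exteriorCutoff R n) :=
  Real.smoothTransition.contDiff.comp
    (contDiff_const.mul ((contDiff_norm_sq ℝ).sub contDiff_const))

lemma fderiv_exteriorCutoff (R : ℝ) (n : ℕ) (x : Space) : fderiv ℝ (exteriorCutoff R n) x =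
    (deriv Real.smoothTransition (n * (‖x‖ ^ 2 - R ^ 2)) * (n * 2)) • innerSL ℝ x := by
  have e1 : HasFDerivAt (fun y : Space => (n : ℝ) * (‖y‖ ^ 2 - R ^ 2))
      ((n : ℝ) • ((2 : ℕ) • innerSL ℝ x)) x :=
    ((hasStrictFDerivAt_norm_sq x).hasFDerivAt.sub_const _).const_mul _
  have e0 : DifferentiableAt ℝ Real.smoothTransition (n * (‖x‖ ^ 2 - R ^ 2)) :=
    (Real.smoothTransition.contDiff (n := 1)).differentiable (by simp) _
  have e2 := (e0.hasDerivAt.comp_hasFDerivAt x e1).fderiv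
  have e3 : (Real.smoothTransition ∘ fun y : Space => (n : ℝ) * (‖y‖ ^ 2 - R ^ 2)) =
      exteriorCutoff R n := rfl
  rw [e3] at e2
  rw [e2]
  ext y
  simp
  ring

/-- The gradient of the cutoff is radial, so only the tangential part of `v` enters. That gradient
is of size `O(n)` on a shell of volume `O(1/n)`, while the tangential part is uniformly small near
the sphere by continuity; the product tends to zero. -/
lemma tendsto_integral_covCross_shell {R : ℝ} (hR : 0 < R) {v φ : Space → Space}
    (hv : Continuous v) (htan : ∀ x, ‖x‖ = R → covCross (innerSL ℝ x) (v x) = 0)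
    (hφ : Continuous φ) (hc : HasCompactSupport φ) :
    Filter.Tendsto (fun n => ∫ x, inner ℝ (covCross (fderiv ℝ (exteriorCutoff R n) x) (v x)) (φ x))
      Filter.atTop (nhds 0) := by
  obtain ⟨C, hC0, hC⟩ := exists_abs_deriv_smoothTransition_le
  obtain ⟨B, hB0, hB⟩ := volume_shell_le hR
  obtain ⟨Φ, hΦ⟩ := hφ.bounded_above_of_compact_support hc
  have hΦ0 : 0 ≤ Φ := (norm_nonneg _).trans (hΦ 0)
  let τ : Space → Space := fun x => covCross (innerSL ℝ x) (v x)
  have hτ : Continuous τ := Continuous.comp (g := fun q : (Space →L[ℝ] ℝ) × Space => covCross q.1 q.2)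
    (f := fun x : Space => (innerSL ℝ x, v x)) continuous_covCross
    ((innerSL ℝ : Space →L[ℝ] Space →L[ℝ] ℝ).continuous.prodMk hv)
  rw [Metric.tendsto_atTop]
  intro ε hε
  -- `Q` is what remains of gradient size times shell volume times the bound of `φ`, once the powers
  -- of `n` cancel.
  let Q : ℝ := C * 2 * Φ * B / (2 * R)
  have hQ : 0 ≤ Q := by positivity
  obtain ⟨δ, hδ, hsmall⟩ := exists_norm_le_near_sphere hR hτ htan
    (show 0 < ε / (Q + 1) by positivity)
  obtain ⟨N, hN⟩ := exists_nat_gt (max (1 / (2 * R)) (1 / (2 * R * δ)))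
  refine ⟨N, fun n hn => ?_⟩
  have hn' : max (1 / (2 * R)) (1 / (2 * R * δ)) < n := hN.trans_le (by exact_mod_cast hn)
  have hn1 := (le_max_left _ _).trans_lt hn'
  have hn2 := (le_max_right _ _).trans_lt hn'
  have hnp : (0 : ℝ) < n := lt_trans (by positivity) hn1
  -- Thickness of the shell: `‖x‖² - R² ≤ 1/n = 2 R d` forces `‖x‖ ≤ R + d`.
  let d : ℝ := 1 / (2 * R * n)
  have hd0 : 0 < d := by positivity
  have hd1 : d ≤ 1 := by
    rw [div_lt_iff₀ (by positivity)] at hn1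
    rw [div_le_one (by positivity)]; linarith
  have hdδ : d < δ := by
    rw [div_lt_iff₀ (by positivity)] at hn2
    rw [div_lt_iff₀ (by positivity)]; linarith
  have hpt : ∀ x, ‖inner ℝ (covCross (fderiv ℝ (exteriorCutoff R n) x) (v x)) (φ x)‖ ≤
      (Metric.closedBall (0 : Space) (R + d) \ Metric.ball 0 R).indicator
        (fun _ => C * (n * 2) * (ε / (Q + 1)) * Φ) x := fun x => by
    rw [fderiv_exteriorCutoff, covCross_smul, real_inner_smul_left]
    by_cases hs : (n : ℝ) * (‖x‖ ^ 2 - R ^ 2) ∈ Icc (0 : ℝ) 1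
    · have hge : R ≤ ‖x‖ := by
        have : 0 ≤ ‖x‖ ^ 2 - R ^ 2 := nonneg_of_mul_nonneg_right hs.1 hnp
        nlinarith [norm_nonneg x]
      have hle : ‖x‖ ≤ R + d := by
        have h1 : ‖x‖ ^ 2 - R ^ 2 ≤ 1 / n := by
          rw [le_div_iff₀ hnp]; linarith [hs.2]
        have h2 : 2 * R * d = 1 / n := by simp only [d]; field_simp
        refine abs_le_of_sq_le_sq' ?_ (by positivity) |>.2
        nlinarith [sq_nonneg d]
      rw [indicator_of_mem (show x ∈ Metric.closedBall (0 : Space) (R + d) \ Metric.ball 0 R from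
        ⟨by simpa using hle, by simpa using hge⟩)]
      have h3 := hsmall x hge (by linarith)
      rw [norm_mul, norm_mul, Real.norm_eq_abs, Real.norm_of_nonneg (show 0 ≤ (n : ℝ) * 2 by positivity),
        mul_assoc (C * (n * 2))]
      refine mul_le_mul (mul_le_mul_of_nonneg_right (hC _).1 (by positivity)) ?_ (norm_nonneg _)
        (by positivity)
      refine (norm_inner_le_norm _ _).trans ?_
      exact mul_le_mul h3 (hΦ x) (norm_nonneg _) (by positivity)
    · rw [(hC _).2 hs, zero_mul, zero_mul, norm_zero]
      exact indicator_nonneg (fun _ _ => by positivity) _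
  have hmeas : MeasurableSet (Metric.closedBall (0 : Space) (R + d) \ Metric.ball 0 R) :=
    Metric.isClosed_closedBall.measurableSet.diff Metric.isOpen_ball.measurableSet
  have hfin : volume (Metric.closedBall (0 : Space) (R + d) \ Metric.ball 0 R) ≠ ⊤ :=
    ((measure_mono sdiff_subset).trans_lt measure_closedBall_lt_top).ne
  have hI := norm_integral_le_of_norm_le (μ := (volume : Measure Space))
    ((integrable_indicator_iff hmeas).2 (integrableOn_const hfin)) (Filter.Eventually.of_forall hpt)
  rw [integral_indicator_const _ hmeas, smul_eq_mul] at hI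
  rw [dist_zero_right]
  refine hI.trans_lt ?_
  calc volume.real (Metric.closedBall (0 : Space) (R + d) \ Metric.ball 0 R)
        * (C * (n * 2) * (ε / (Q + 1)) * Φ)
      ≤ (B * d) * (C * (n * 2) * (ε / (Q + 1)) * Φ) :=
        mul_le_mul_of_nonneg_right (hB d hd0.le hd1) (by positivity)
    _ = Q / (Q + 1) * ε := by simp only [d, Q]; field_simp
    _ < 1 * ε := by
        refine mul_lt_mul_of_pos_right ?_ hε
        rw [div_lt_one (by positivity)]; linarith
    _ = ε := one_mul ε

/-- Extension by zero of a field whose tangential trace on a sphere vanishes: the restriction to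
the exterior of the ball keeps a weak curl without singular part on the sphere. -/
lemma IsWeakCurl.indicator_exterior {R : ℝ} (hR : 0 < R) {v c : Space → Space} (hv : Continuous v)
    (h : IsWeakCurl v c) (htan : ∀ x, ‖x‖ = R → covCross (innerSL ℝ x) (v x) = 0) :
    IsWeakCurl ({x : Space | R < ‖x‖}.indicator v) ({x : Space | R < ‖x‖}.indicator c) := by
  have hS : MeasurableSet {x : Space | R < ‖x‖} := (isOpen_lt continuous_const continuous_norm).measurableSet
  refine ⟨h.1.indicator hS, h.2.1.indicator hS, fun φ hφ hc => ?_⟩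
  let X : ℕ → Space → ℝ := exteriorCutoff R
  have hX : ∀ n, ContDiff ℝ ∞ (X n) := contDiff_exteriorCutoff R
  have hX1 : ∀ n x, |X n x| ≤ 1 := fun n x => by
    simp only [X, exteriorCutoff]
    rw [abs_of_nonneg (Real.smoothTransition.nonneg _)]; exact Real.smoothTransition.le_one _
  have hXlim : ∀ x, ∀ᶠ n in Filter.atTop, X n x = {x : Space | R < ‖x‖}.indicator 1 x := fun x => by
    by_cases hx : R < ‖x‖
    · have hpos : 0 < ‖x‖ ^ 2 - R ^ 2 := by nlinarith
      obtain ⟨N, hN⟩ := exists_nat_ge (1 / (‖x‖ ^ 2 - R ^ 2))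
      filter_upwards [Filter.eventually_ge_atTop N] with n hn
      rw [indicator_of_mem (show x ∈ {x : Space | R < ‖x‖} from hx)]
      refine Real.smoothTransition.one_of_one_le ?_
      rw [← div_le_iff₀ hpos]
      exact hN.trans (by exact_mod_cast hn)
    · refine Filter.Eventually.of_forall fun n => ?_
      rw [indicator_of_notMem (show x ∉ {x : Space | R < ‖x‖} from hx)]
      refine Real.smoothTransition.zero_of_nonpos ?_
      refine mul_nonpos_of_nonneg_of_nonpos n.cast_nonneg ?_
      have := norm_nonneg x
      nlinarith
  have hlim : ∀ {f ψ : Space → Space}, LocallyIntegrable f volume → Continuous ψ →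
      HasCompactSupport ψ → Filter.Tendsto (fun n => ∫ x, inner ℝ (X n x • f x) (ψ x)) Filter.atTop
        (nhds (∫ x, inner ℝ ({x : Space | R < ‖x‖}.indicator f x) (ψ x))) := by
    intro f ψ hf hψ hψc
    have hi := hf.integrable_inner_of_hasCompactSupport hψ hψc
    refine tendsto_integral_of_dominated_convergence (fun x => ‖inner ℝ (f x) (ψ x)‖)
      (fun n => ?_) hi.norm (fun n => ?_) ?_
    · exact ((hX n).continuous.aestronglyMeasurable.smul hf.aestronglyMeasurable).inner
        hψ.aestronglyMeasurable
    · refine Filter.Eventually.of_forall fun x => ?_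
      rw [real_inner_smul_left, norm_mul, Real.norm_eq_abs]
      exact mul_le_of_le_one_left (norm_nonneg _) (hX1 n x)
    · refine Filter.Eventually.of_forall fun x => ?_
      refine tendsto_const_nhds.congr' ?_
      filter_upwards [hXlim x] with n hn
      rw [hn]
      by_cases hx : x ∈ {x : Space | R < ‖x‖} <;> simp [hx]
  have hrem := tendsto_integral_covCross_shell hR hv htan hφ.continuous hc
  have heq : ∀ n, (∫ x, inner ℝ (X n x • c x) (φ x)) +
      ∫ x, inner ℝ (covCross (fderiv ℝ (X n) x) (v x)) (φ x)
      = ∫ x, inner ℝ (X n x • v x) (curl φ x) := fun n => by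
    have hs := h.smul (hX n)
    have l1 : LocallyIntegrable (fun x => X n x • c x) volume :=
      h.2.1.continuous_smul (hX n).continuous
    have l2 : LocallyIntegrable (fun x => covCross (fderiv ℝ (X n) x) (v x)) volume := by
      refine (hs.2.1.sub l1).congr (Filter.Eventually.of_forall fun x => ?_)
      simp
    rw [← hs.2.2 φ hφ hc, ← integral_add (l1.integrable_inner_of_hasCompactSupport hφ.continuous hc)
      (l2.integrable_inner_of_hasCompactSupport hφ.continuous hc)]
    simp only [inner_add_left]
  have L1 := (hlim h.2.1 hφ.continuous hc).add hrem
  have L2 := hlim h.1 (contDiff_curl hφ).continuous (hasCompactSupport_curl hc)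
  rw [add_zero] at L1
  exact tendsto_nhds_unique (L1.congr heq) L2

/-! ### Solutions as curves in `L²`. -/

/-- A solution of `∂ₜ² e + ∇ × (∇ × e) = f` with vanishing initial data, together with its first
two time derivatives and its curl as curves in `L²`. -/
structure MaxwellCurve (T : ℝ) (f e : ℝ → Space → Space)
    (D D₁ D₂ C : ℝ → Lp Space 2 (volume : Measure Space)) : Prop where
  continuous : ∀ t ∈ Icc 0 T, Continuous (e t)
  ae_eq : ∀ t ∈ Icc 0 T, D t =ᵐ[volume] e t
  hasDeriv : ∀ t ∈ Icc 0 T, HasDerivWithinAt D (D₁ t) (Icc 0 T) t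
  hasDeriv₁ : ∀ t ∈ Icc 0 T, HasDerivWithinAt D₁ (D₂ t) (Icc 0 T) t
  continuousOn₂ : ContinuousOn D₂ (Icc 0 T)
  zero : D 0 = 0
  zero₁ : D₁ 0 = 0
  continuousOn_curl : ContinuousOn C (Icc 0 T)
  weakCurl : ∀ t ∈ Icc 0 T, IsWeakCurl (D t) (C t)
  equation : ∀ t ∈ Ioo 0 T, ∃ cc : Space → Space, IsWeakCurl (C t) cc ∧
    ∀ᵐ x ∂(volume : Measure Space), D₂ t x + cc x = f t x

/-- The equation supplies some weak curl at each time separately; by uniqueness it agrees with the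
continuous curve of curls that comes from the `H²` regularity. -/
lemma IsMaxwellSolution.exists_maxwellCurve {T : ℝ} (hT : 0 < T) {f E : ℝ → Space → Space}
    (h : IsMaxwellSolution T f E) : ∃ D D₁ D₂ C, MaxwellCurve T f E D D₁ D₂ C := by
  obtain ⟨hcont, U, hUE, hUH, hUC, h0, h1, heq⟩ := h
  obtain ⟨C, hC, hCc⟩ := hUH.exists_weakCurl
  have hu : UniqueDiffOn ℝ (Icc 0 T) := uniqueDiffOn_Icc hT
  have h2 : iteratedDerivWithin 2 U (Icc 0 T)
      = derivWithin (iteratedDerivWithin 1 U (Icc 0 T)) (Icc 0 T) :=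
    iteratedDerivWithin_succ
  have h3 : EqOn (iteratedDerivWithin 1 U (Icc 0 T)) (derivWithin U (Icc 0 T)) (Icc 0 T) :=
    fun t _ => congrFun iteratedDerivWithin_one t
  have hd1 : DifferentiableOn ℝ (iteratedDerivWithin 1 U (Icc 0 T)) (Icc 0 T) :=
    hUC.differentiableOn_iteratedDerivWithin (by norm_num) hu
  refine ⟨U, iteratedDerivWithin 1 U (Icc 0 T), iteratedDerivWithin 2 U (Icc 0 T), C,
    hcont, hUE, fun t ht => ?_, fun t ht => ?_, ?_, h0, ?_, hC, hCc, fun t ht => ?_⟩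
  · rw [h3 ht]
    exact (hUC.differentiableOn (by norm_num) t ht).hasDerivWithinAt
  · rw [h2]
    exact (hd1 t ht).hasDerivWithinAt
  · exact hUC.continuousOn_iteratedDerivWithin (by norm_num) hu
  · rw [h3 (left_mem_Icc.2 hT.le), h1]
  · obtain ⟨c, cc, hc, hcc, h4⟩ := heq t ht
    have ht' : t ∈ Icc 0 T := Ioo_subset_Icc_self ht
    refine ⟨cc, hcc.congr ?_ (Filter.EventuallyEq.refl _ _), h4⟩
    exact hc.unique ((hCc t ht').congr (hUE t ht') (Filter.EventuallyEq.refl _ _))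

namespace MaxwellCurve

variable {T : ℝ} {f e f' e' : ℝ → Space → Space}
  {D D₁ D₂ C D' D₁' D₂' C' : ℝ → Lp Space 2 (volume : Measure Space)}

lemma sub (h : MaxwellCurve T f e D D₁ D₂ C) (h' : MaxwellCurve T f' e' D' D₁' D₂' C') :
    MaxwellCurve T (fun t x => f t x - f' t x) (fun t x => e t x - e' t x)
      (fun t => D t - D' t) (fun t => D₁ t - D₁' t) (fun t => D₂ t - D₂' t)
      (fun t => C t - C' t) where
  continuous t ht := (h.continuous t ht).sub (h'.continuous t ht)
  ae_eq t ht := by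
    filter_upwards [Lp.coeFn_sub (D t) (D' t), h.ae_eq t ht, h'.ae_eq t ht] with x h1 h2 h3
    rw [h1, Pi.sub_apply, h2, h3]
  hasDeriv t ht := (h.hasDeriv t ht).sub (h'.hasDeriv t ht)
  hasDeriv₁ t ht := (h.hasDeriv₁ t ht).sub (h'.hasDeriv₁ t ht)
  continuousOn₂ := h.continuousOn₂.sub h'.continuousOn₂
  zero := by rw [h.zero, h'.zero, sub_zero]
  zero₁ := by rw [h.zero₁, h'.zero₁, sub_zero]
  continuousOn_curl := h.continuousOn_curl.sub h'.continuousOn_curl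
  weakCurl t ht := ((h.weakCurl t ht).sub (h'.weakCurl t ht)).congr
    (Lp.coeFn_sub (D t) (D' t)).symm (Lp.coeFn_sub (C t) (C' t)).symm
  equation t ht := by
    obtain ⟨cc, hcc, h1⟩ := h.equation t ht
    obtain ⟨cc', hcc', h1'⟩ := h'.equation t ht
    refine ⟨fun x => cc x - cc' x, (hcc.sub hcc').congr (Lp.coeFn_sub (C t) (C' t)).symm
      (Filter.EventuallyEq.refl _ _), ?_⟩
    filter_upwards [Lp.coeFn_sub (D₂ t) (D₂' t), h1, h1'] with x h2 h3 h4
    rw [h2, Pi.sub_apply, ← h3, ← h4]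
    abel

end MaxwellCurve

/-! ### Uniqueness in the exterior of the ball. -/

section Energy

variable {H : Type*} [NormedAddCommGroup H] [InnerProductSpace ℝ H]

lemma inner_add_inner_integral_eq_zero [CompleteSpace H] {u c : ℝ → H} (hu : Continuous u)
    (hc : Continuous c) {p q : H} {t s : ℝ} (hts : t ≤ s)
    (h : ∀ r ∈ Icc t s, inner ℝ p (u r) + inner ℝ q (c r) = 0) :
    inner ℝ p (∫ r in t..s, u r) + inner ℝ q (∫ r in t..s, c r) = 0 := by
  have h1 : inner ℝ p (∫ r in t..s, u r) = ∫ r in t..s, inner ℝ p (u r) :=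
    ((innerSL ℝ p).intervalIntegral_comp_comm (hu.intervalIntegrable _ _)).symm
  have h2 : inner ℝ q (∫ r in t..s, c r) = ∫ r in t..s, inner ℝ q (c r) :=
    ((innerSL ℝ q).intervalIntegral_comp_comm (hc.intervalIntegrable _ _)).symm
  rw [h1, h2, ← intervalIntegral.integral_add
    ((continuous_const.inner hu).intervalIntegrable _ _)
    ((continuous_const.inner hc).intervalIntegrable _ _)]
  rw [intervalIntegral.integral_congr (g := fun _ => (0 : ℝ)), intervalIntegral.integral_zero]
  intro r hr
  rw [uIcc_of_le hts] at hr
  exact h r hr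

/-- Uniqueness for an abstract second order evolution equation in symmetric weak form, with
vanishing initial data. -/
lemma eq_zero_of_inner_add_inner [CompleteSpace H] {T : ℝ} (hT : 0 < T) {u u₁ u₂ c : ℝ → H}
    (hu : ∀ t ∈ Icc 0 T, HasDerivWithinAt u (u₁ t) (Icc 0 T) t)
    (hu₁ : ∀ t ∈ Icc 0 T, HasDerivWithinAt u₁ (u₂ t) (Icc 0 T) t)
    (h0 : u 0 = 0) (h1 : u₁ 0 = 0) (hc : ContinuousOn c (Icc 0 T))
    (hpair : ∀ t ∈ Ioo 0 T, ∀ s ∈ Ioo 0 T, inner ℝ (u₂ t) (u s) + inner ℝ (c t) (c s) = 0) :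
    ∀ s ∈ Icc 0 T, u s = 0 := by
  intro s hs
  rcases hs.1.eq_or_lt with rfl | hs0
  · exact h0
  have huc : ContinuousOn u (Icc 0 T) := fun t ht => (hu t ht).continuousWithinAt
  have hu₁c : ContinuousOn u₁ (Icc 0 T) := fun t ht => (hu₁ t ht).continuousWithinAt
  -- The pairing is given on the open interval only; continuity in the second time extends it to the
  -- endpoints, so that `s = T` is allowed below.
  have hpair' : ∀ t ∈ Ioo 0 T, ∀ r ∈ Icc 0 T,
      inner ℝ (u₂ t) (u r) + inner ℝ (c t) (c r) = 0 := fun t ht => by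
    have hcl : Icc 0 T ⊆ closure (Ioo 0 T) := by rw [closure_Ioo hT.ne]
    exact EqOn.of_subset_closure (s := Ioo 0 T) (t := Icc 0 T) (g := fun _ => (0 : ℝ)) (hpair t ht)
      ((continuousOn_const.inner huc).add (continuousOn_const.inner hc)) continuousOn_const
      Ioo_subset_Icc_self hcl
  let ue : ℝ → H := IccExtend hT.le ((Icc 0 T).domRestrict u)
  let ce : ℝ → H := IccExtend hT.le ((Icc 0 T).domRestrict c)
  have huec : Continuous ue := (continuousOn_iff_continuous_domRestrict.1 huc).Icc_extend'
  have hcec : Continuous ce := (continuousOn_iff_continuous_domRestrict.1 hc).Icc_extend'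
  have hue : ∀ t ∈ Icc 0 T, ue t = u t := fun t ht => IccExtend_of_mem _ _ ht
  have hce : ∀ t ∈ Icc 0 T, ce t = c t := fun t ht => IccExtend_of_mem _ _ ht
  -- Testing with `v`, for which `v' = -u` and `v s = 0`, instead of with `u₁`, avoids any time
  -- derivative of the curl.
  let v : ℝ → H := fun t => ∫ r in t..s, ue r
  let γ : ℝ → H := fun t => ∫ r in t..s, ce r
  have hv : ∀ t, HasDerivAt v (-ue t) t := fun t =>
    intervalIntegral.integral_hasDerivAt_left (huec.intervalIntegrable _ _)
      huec.stronglyMeasurable.stronglyMeasurableAtFilter huec.continuousAt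
  have hγ : ∀ t, HasDerivAt γ (-ce t) t := fun t =>
    intervalIntegral.integral_hasDerivAt_left (hcec.intervalIntegrable _ _)
      hcec.stronglyMeasurable.stronglyMeasurableAtFilter hcec.continuousAt
  -- `Φ' = ⟨u₂, v⟩ + ⟨c, γ⟩ = 0` by the integrated pairing. Since `Φ s = ‖u s‖² / 2` and `Φ 0 = -‖γ
  -- 0‖² / 2`, constancy forces `u s = 0`.
  let Φ : ℝ → ℝ := fun t =>
    inner ℝ (u₁ t) (v t) + ((1 / 2) * inner ℝ (u t) (u t) - (1 / 2) * inner ℝ (γ t) (γ t))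
  have hsub : Icc 0 s ⊆ Icc 0 T := Icc_subset_Icc_right hs.2
  have hvc : Continuous v := continuous_iff_continuousAt.2 fun t => (hv t).continuousAt
  have hγc : Continuous γ := continuous_iff_continuousAt.2 fun t => (hγ t).continuousAt
  have hΦc : ContinuousOn Φ (Icc 0 s) := by
    have a1 := hu₁c.mono hsub
    have a2 := huc.mono hsub
    exact (a1.inner hvc.continuousOn).add (((a2.inner a2).const_mul _).sub
      ((hγc.inner hγc).continuousOn.const_mul _))
  have hΦd : ∀ t ∈ Ioo 0 s, HasDerivAt Φ 0 t := fun t ht => by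
    have ht' : t ∈ Ioo 0 T := ⟨ht.1, ht.2.trans_le hs.2⟩
    have htc := Ioo_subset_Icc_self ht'
    have hn := Icc_mem_nhds ht'.1 ht'.2
    have d1 := (hu t htc).hasDerivAt hn
    have d2 := (hu₁ t htc).hasDerivAt hn
    have d3 := (d2.inner ℝ (hv t)).add
      (((d1.inner ℝ d1).const_mul (1 / 2)).sub (((hγ t).inner ℝ (hγ t)).const_mul (1 / 2)))
    have key := inner_add_inner_integral_eq_zero huec hcec (p := u₂ t) (q := c t) ht.2.le
      fun r hr => by
        have hr' : r ∈ Icc 0 T := ⟨ht.1.le.trans hr.1, hr.2.trans hs.2⟩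
        rw [hue r hr', hce r hr']
        exact hpair' t ht' r hr'
    refine d3.congr_deriv ?_
    change inner ℝ (u₂ t) (v t) + inner ℝ (c t) (γ t) = 0 at key
    rw [hue t htc, hce t htc, inner_neg_right, inner_neg_right, inner_neg_left,
      real_inner_comm (u t) (u₁ t), real_inner_comm (γ t) (c t)]
    rw [real_inner_comm (u t) (u₁ t), real_inner_comm (γ t) (c t)] at *
    linarith
  obtain ⟨r, hr, hslope⟩ := exists_hasDerivAt_eq_slope Φ (fun _ => 0) hs0 hΦc hΦd
  have hΦ : Φ s = Φ 0 := by
    have : s - 0 ≠ 0 := by simpa using hs0.ne'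
    rw [eq_comm, div_eq_zero_iff] at hslope
    rcases hslope with h | h
    · linarith
    · exact absurd h this
  have hvs : v s = 0 := intervalIntegral.integral_same
  have hγs : γ s = 0 := intervalIntegral.integral_same
  simp only [Φ, hvs, hγs, h0, h1, inner_zero_left, inner_zero_right] at hΦ
  have e1 := real_inner_self_nonneg (x := u s)
  have e2 := real_inner_self_nonneg (x := γ 0)
  exact inner_self_eq_zero (𝕜 := ℝ).1 (by linarith)

end Energy

namespace MaxwellCurve

variable {T : ℝ} {f e : ℝ → Space → Space}
  {D D₁ D₂ C : ℝ → Lp Space 2 (volume : Measure Space)}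

/-- A solution whose tangential trace on a sphere vanishes, with a source supported inside the
sphere, vanishes outside. -/
lemma ae_eq_zero_exterior (h : MaxwellCurve T f e D D₁ D₂ C) (hT : 0 < T) {R : ℝ} (hR : 0 < R)
    (hf : ∀ t ∈ Ioo 0 T, MemLp (f t) 2 volume)
    (hfS : ∀ t ∈ Ioo 0 T, ∀ x, R < ‖x‖ → f t x = 0)
    (htan : ∀ t ∈ Ioo 0 T, ∀ x, ‖x‖ = R → covCross (innerSL ℝ x) (e t x) = 0) :
    ∀ t ∈ Icc 0 T, (∀ᵐ x, R < ‖x‖ → D t x = 0) ∧ (∀ᵐ x, R < ‖x‖ → D₁ t x = 0) := by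
  have hS : MeasurableSet {x : Space | R < ‖x‖} :=
    (isOpen_lt continuous_const continuous_norm).measurableSet
  let P := LpToLpRestrictCLM Space Space ℝ (volume : Measure Space) 2 {x : Space | R < ‖x‖}
  have hinner : ∀ F G : Lp Space 2 (volume : Measure Space), inner ℝ (P F) (P G)
      = ∫ x, inner ℝ (F x) ({x : Space | R < ‖x‖}.indicator G x) := fun F G => by
    have e1 : ∀ x, inner ℝ (F x) ({x : Space | R < ‖x‖}.indicator G x)
        = {x : Space | R < ‖x‖}.indicator (fun x => inner ℝ (F x) (G x)) x := fun x => by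
      by_cases hx : x ∈ {x : Space | R < ‖x‖} <;> simp [hx]
    simp only [e1]
    rw [L2.inner_def, integral_indicator hS]
    refine integral_congr_ae ?_
    filter_upwards [LpToLpRestrictCLM_coeFn ℝ {x : Space | R < ‖x‖} F,
      LpToLpRestrictCLM_coeFn ℝ {x : Space | R < ‖x‖} G] with x h1 h2
    rw [h1, h2]
  have hPd : ∀ {V V₁ : ℝ → Lp Space 2 (volume : Measure Space)} {t : ℝ},
      HasDerivWithinAt V (V₁ t) (Icc 0 T) t →
      HasDerivWithinAt (fun t => P (V t)) (P (V₁ t)) (Icc 0 T) t := fun hV =>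
    P.hasFDerivAt.comp_hasDerivWithinAt _ hV
  -- The equation at time `t` is tested with the zero extension of the field at an independent time
  -- `s`; symmetry of the curl on `L²` then moves one curl onto that extension.
  have hpair : ∀ t ∈ Ioo 0 T, ∀ s ∈ Ioo 0 T,
      inner ℝ (P (D₂ t)) (P (D s)) + inner ℝ (P (C t)) (P (C s)) = 0 := by
    intro t ht s hs
    obtain ⟨cc, hcc, heq⟩ := h.equation t ht
    have hsc := Ioo_subset_Icc_self hs
    have hccL : MemLp cc 2 volume := by
      refine ((hf t ht).sub (Lp.memLp (D₂ t))).ae_eq ?_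
      filter_upwards [heq] with x hx
      rw [Pi.sub_apply, ← hx, add_sub_cancel_left]
    have hind := ((h.weakCurl s hsc).congr (h.ae_eq s hsc)
      (Filter.EventuallyEq.refl _ _)).indicator_exterior hR (h.continuous s hsc) (htan s hs)
    have hzD : {x : Space | R < ‖x‖}.indicator (D s) =ᵐ[volume]
        {x : Space | R < ‖x‖}.indicator (e s) := by
      filter_upwards [h.ae_eq s hsc] with x hx
      by_cases hx' : x ∈ {x : Space | R < ‖x‖} <;> simp [hx', hx]
    have hind' := hind.congr hzD.symm (Filter.EventuallyEq.refl _ _)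
    have key := integral_inner_weakCurl_comm ((Lp.memLp (D s)).indicator hS)
      ((Lp.memLp (C s)).indicator hS) (Lp.memLp (C t)) hccL hind' hcc
    rw [hinner, hinner, ← key, ← integral_add]
    · refine integral_eq_zero_of_ae ?_
      filter_upwards [heq] with x hx
      by_cases hx' : x ∈ {x : Space | R < ‖x‖}
      · rw [← inner_add_left, hx, hfS t ht x hx', inner_zero_left]; rfl
      · simp [hx']
    · exact (Lp.memLp (D₂ t)).integrable_inner' ((Lp.memLp (D s)).indicator hS)
    · exact hccL.integrable_inner' ((Lp.memLp (D s)).indicator hS)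
  have hzero : ∀ t ∈ Icc 0 T, P (D t) = 0 :=
    eq_zero_of_inner_add_inner hT (fun t ht => hPd (h.hasDeriv t ht))
      (fun t ht => hPd (h.hasDeriv₁ t ht)) (by rw [h.zero, map_zero]) (by rw [h.zero₁, map_zero])
      (P.continuous.comp_continuousOn h.continuousOn_curl) hpair
  have hzero₁ : ∀ t ∈ Icc 0 T, P (D₁ t) = 0 := fun t ht => by
    have e1 := hPd (h.hasDeriv t ht)
    have e2 : HasDerivWithinAt (fun t => P (D t)) 0 (Icc 0 T) t :=
      (hasDerivWithinAt_const t (Icc 0 T) (0 : Lp Space 2 _)).congr hzero (hzero t ht)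
    exact (uniqueDiffOn_Icc hT t ht).eq_deriv _ e1 e2
  have hae : ∀ F : Lp Space 2 (volume : Measure Space), P F = 0 →
      ∀ᵐ x, R < ‖x‖ → F x = 0 := fun F hF => by
    refine (ae_restrict_iff' hS).1 ?_
    have e1 := LpToLpRestrictCLM_coeFn ℝ {x : Space | R < ‖x‖} F
    have e2 : (P F : Space → Space) =ᵐ[volume.restrict {x : Space | R < ‖x‖}] 0 := by
      rw [hF]; exact Lp.coeFn_zero _ _ _
    filter_upwards [e1, e2] with x h1 h2
    rw [← h1]; exact h2
  exact fun t ht => ⟨hae _ (hzero t ht), hae _ (hzero₁ t ht)⟩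

end MaxwellCurve

/-! ### Testing with transversal plane waves. -/

/-- The remainder is uniform in the base point, so at each `x` the difference quotients of a plane
wave are controlled independently of the phase `θ·x`; this gives differentiability in `L²`. -/
lemma exists_abs_taylor_le {φ : ℝ → ℝ} (hφ : ContDiff ℝ ∞ φ) (hc : HasCompactSupport φ) :
    ∃ M : ℝ, 0 ≤ M ∧ ∀ s r, |φ r - φ s - (r - s) * deriv φ s| ≤ M * |r - s| ^ 2 := by
  have hφ1 : ContDiff ℝ ∞ (deriv φ) := hφ.deriv' (n := ∞)
  obtain ⟨M, hM⟩ := (hφ1.continuous_deriv (by simp)).bounded_above_of_compact_support hc.deriv.deriv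
  refine ⟨M, (norm_nonneg _).trans (hM 0), fun s r => ?_⟩
  have h1 : ∀ a b, |deriv φ b - deriv φ a| ≤ M * |b - a| := fun a b =>
    Convex.norm_image_sub_le_of_norm_deriv_le
      (fun x _ => hφ1.differentiable (by simp) x) (fun x _ => hM x) convex_univ
      (mem_univ a) (mem_univ b)
  have hd : ∀ y, HasDerivAt (fun y => φ y - y * deriv φ s) (deriv φ y - 1 * deriv φ s) y := fun y =>
    (hφ.differentiable (by simp) y).hasDerivAt.sub ((hasDerivAt_id y).mul_const _)
  have h2 := Convex.norm_image_sub_le_of_norm_deriv_le (f := fun y => φ y - y * deriv φ s)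
    (C := M * |r - s|) (s := uIcc s r) (x := s) (y := r)
    (fun y _ => (hd y).differentiableAt) (fun y hy => by
      rw [(hd y).deriv, one_mul]
      refine (h1 s y).trans (mul_le_mul_of_nonneg_left ?_ ((norm_nonneg _).trans (hM 0)))
      exact abs_sub_left_of_mem_uIcc hy) (convex_uIcc s r) left_mem_uIcc right_mem_uIcc
  rw [Real.norm_eq_abs, Real.norm_eq_abs] at h2
  calc |φ r - φ s - (r - s) * deriv φ s|
      = |φ r - r * deriv φ s - (φ s - s * deriv φ s)| := by congr 1; ring
    _ ≤ M * |r - s| * |r - s| := h2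
    _ = M * |r - s| ^ 2 := by ring

/-- The plane wave `φ(t - θ·x) p`, multiplied by a cutoff function in space. -/
def planeWave (κ : Space → ℝ) (θ p : Space) (φ : ℝ → ℝ) (t : ℝ) (x : Space) : Space :=
  (κ x * φ (t - inner ℝ θ x)) • p

section PlaneWave

variable {κ : Space → ℝ} {θ p : Space} {φ : ℝ → ℝ}

lemma contDiff_planeWave (hκ : ContDiff ℝ ∞ κ) (hφ : ContDiff ℝ ∞ φ) (t : ℝ) :
    ContDiff ℝ ∞ (planeWave κ θ p φ t) :=
  (hκ.mul (hφ.comp (contDiff_const.sub (contDiff_const.inner ℝ contDiff_id)))).smul contDiff_const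

lemma hasCompactSupport_planeWave (hκ : HasCompactSupport κ) (t : ℝ) :
    HasCompactSupport (planeWave κ θ p φ t) :=
  hκ.mono fun x hx h0 => hx (by simp [planeWave, h0])

lemma memLp_planeWave (hκ : ContDiff ℝ ∞ κ) (hκc : HasCompactSupport κ) (hφ : ContDiff ℝ ∞ φ)
    (t : ℝ) : MemLp (planeWave κ θ p φ t) 2 volume :=
  (contDiff_planeWave hκ hφ t).continuous.memLp_of_hasCompactSupport
    (hasCompactSupport_planeWave hκc t)

/-- The curve in `L²` given by a plane wave is differentiable in time. -/
lemma hasDerivAt_planeWave (hκ : ContDiff ℝ ∞ κ) (hκc : HasCompactSupport κ)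
    (hφ : ContDiff ℝ ∞ φ) (hφc : HasCompactSupport φ) (hφ' : ContDiff ℝ ∞ (deriv φ)) (t : ℝ) :
    HasDerivAt (fun t => (memLp_planeWave (θ := θ) (p := p) hκ hκc hφ t).toLp)
      ((memLp_planeWave (θ := θ) (p := p) hκ hκc hφ' t).toLp) t := by
  obtain ⟨M, hM0, hM⟩ := exists_abs_taylor_le hφ hφc
  have hg : MemLp (fun x => κ x • p) 2 (volume : Measure Space) :=
    (hκ.continuous.smul continuous_const).memLp_of_hasCompactSupport hκc.smul_right
  rw [hasDerivAt_iff_tendsto]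
  have hb : ∀ s, ‖s - t‖⁻¹ * ‖(memLp_planeWave (θ := θ) (p := p) hκ hκc hφ s).toLp
      - (memLp_planeWave (θ := θ) (p := p) hκ hκc hφ t).toLp
      - (s - t) • (memLp_planeWave (θ := θ) (p := p) hκ hκc hφ' t).toLp‖
      ≤ ‖s - t‖ * (M * ‖hg.toLp‖) := fun s => by
    have h1 : ‖(memLp_planeWave (θ := θ) (p := p) hκ hκc hφ s).toLp
      - (memLp_planeWave (θ := θ) (p := p) hκ hκc hφ t).toLp
      - (s - t) • (memLp_planeWave (θ := θ) (p := p) hκ hκc hφ' t).toLp‖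
        ≤ M * |s - t| ^ 2 * ‖hg.toLp‖ := by
      rw [← MemLp.toLp_sub, ← MemLp.toLp_const_smul, ← MemLp.toLp_sub]
      refine Lp.norm_le_mul_norm_of_ae_le_mul ?_
      filter_upwards [hg.coeFn_toLp, MemLp.coeFn_toLp
        (((memLp_planeWave (θ := θ) (p := p) hκ hκc hφ s).sub
          (memLp_planeWave (θ := θ) (p := p) hκ hκc hφ t)).sub
          ((memLp_planeWave (θ := θ) (p := p) hκ hκc hφ' t).const_smul (s - t)))] with x h2 h3
      rw [h3, h2]
      have h4 : (planeWave κ θ p φ s - planeWave κ θ p φ t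
          - (s - t) • planeWave κ θ p (deriv φ) t) x
          = (φ (s - inner ℝ θ x) - φ (t - inner ℝ θ x)
            - (s - inner ℝ θ x - (t - inner ℝ θ x)) * deriv φ (t - inner ℝ θ x)) • κ x • p := by
        simp only [Pi.sub_apply, Pi.smul_apply, planeWave, smul_smul, ← sub_smul]
        congr 1
        ring
      rw [h4, norm_smul]
      refine mul_le_mul_of_nonneg_right ?_ (norm_nonneg _)
      have := hM (t - inner ℝ θ x) (s - inner ℝ θ x)
      rwa [sub_sub_sub_cancel_right] at this ⊢
    rcases eq_or_ne s t with rfl | hne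
    · simp
    · have hpos : 0 < ‖s - t‖ := norm_pos_iff.2 (sub_ne_zero.2 hne)
      rw [inv_mul_le_iff₀ hpos]
      refine h1.trans (le_of_eq ?_)
      rw [Real.norm_eq_abs]
      ring
  refine squeeze_zero (fun s => by positivity) hb ?_
  have : Filter.Tendsto (fun s : ℝ => ‖s - t‖ * (M * ‖hg.toLp‖)) (nhds t)
      (nhds (‖t - t‖ * (M * ‖hg.toLp‖))) :=
    (((continuous_id.sub continuous_const).norm).mul continuous_const).tendsto t
  simpa using this

/-- For a unit vector `θ` orthogonal to `p` the double product is `-p`, which is why transversal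
waves travel at speed one. -/
lemma covCross_covCross (θ p : Space) :
    covCross (innerSL ℝ θ) (covCross (innerSL ℝ θ) p) = inner ℝ θ p • θ - ‖θ‖ ^ 2 • p := by
  have h1 : ‖θ‖ ^ 2 = θ 0 * θ 0 + θ 1 * θ 1 + θ 2 * θ 2 := by
    rw [← real_inner_self_eq_norm_sq, PiLp.inner_apply, Fin.sum_univ_three]; rfl
  have h2 : inner ℝ θ p = θ 0 * p 0 + θ 1 * p 1 + θ 2 * p 2 := by
    rw [PiLp.inner_apply, Fin.sum_univ_three]; simp; ring
  rw [h1, h2]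
  simp only [covCross_apply]
  ext i
  fin_cases i <;> simp [EuclideanSpace.inner_single_right] <;> ring

lemma curl_scalar_plane (c t : ℝ) (hφ : Differentiable ℝ φ) (q : Space) (x : Space) :
    curl (fun y => (c * φ (t - inner ℝ θ y)) • q) x
      = (-(c * deriv φ (t - inner ℝ θ x))) • covCross (innerSL ℝ θ) q := by
  have e1 : HasFDerivAt (fun y : Space => t - inner ℝ θ y) (-innerSL ℝ θ) x := by
    simpa using ((innerSL ℝ θ).hasFDerivAt (x := x)).const_sub t
  have e2 : HasFDerivAt (fun y => c * φ (t - inner ℝ θ y)) _ x :=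
    ((hφ (t - inner ℝ θ x)).hasDerivAt.comp_hasFDerivAt x e1).const_mul c
  have e3 : curl (fun y => (c * φ (t - inner ℝ θ y)) • q) x
      = (c * φ (t - inner ℝ θ x)) • curl (fun _ => q) x
        + covCross (fderiv ℝ (fun y => c * φ (t - inner ℝ θ y)) x) q :=
    curl_smul e2.differentiableAt (differentiableAt_const q)
  have e4 : curl (fun _ => q) x = 0 := by
    rw [curl_eq, fderiv_fun_const]; exact map_zero _
  rw [e3, e4, smul_zero, zero_add, e2.fderiv, ← covCross_smul]
  congr 1
  ext v
  simp
  ring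

lemma curl_congr {u v : Space → Space} {x : Space} (h : u =ᶠ[nhds x] v) : curl u x = curl v x := by
  rw [curl_eq, curl_eq, h.fderiv_eq]

/-- Transversal plane waves solve the Maxwell system where the cutoff is constant. -/
lemma curl_curl_planeWave (hφ : ContDiff ℝ ∞ φ) (hθ : ‖θ‖ = 1) (hp : inner ℝ θ p = 0)
    {O : Set Space} (hO : IsOpen O) (hκO : ∀ x ∈ O, κ x = 1) (t : ℝ) {x : Space} (hx : x ∈ O) :
    curl (curl (planeWave κ θ p φ t)) x = -planeWave κ θ p (deriv (deriv φ)) t x := by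
  have hφ1 : ContDiff ℝ ∞ (deriv φ) := hφ.deriv' (n := ∞)
  have h1 : ∀ y ∈ O, curl (planeWave κ θ p φ t) y
      = ((-1) * deriv φ (t - inner ℝ θ y)) • covCross (innerSL ℝ θ) p := fun y hy => by
    have e : planeWave κ θ p φ t =ᶠ[nhds y] fun y => (1 * φ (t - inner ℝ θ y)) • p := by
      filter_upwards [hO.mem_nhds hy] with z hz
      rw [planeWave, hκO z hz]
    rw [curl_congr e, curl_scalar_plane 1 t (hφ.differentiable (by simp))]
    congr 1
    ring
  have e : curl (planeWave κ θ p φ t) =ᶠ[nhds x]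
      fun y => ((-1) * deriv φ (t - inner ℝ θ y)) • covCross (innerSL ℝ θ) p := by
    filter_upwards [hO.mem_nhds hx] with z hz using h1 z hz
  rw [curl_congr e, curl_scalar_plane (-1) t (hφ1.differentiable (by simp)), covCross_covCross,
    hp, hθ, planeWave, hκO x hx]
  simp

end PlaneWave

namespace MaxwellCurve

variable {T : ℝ} {f e : ℝ → Space → Space}
  {D D₁ D₂ C : ℝ → Lp Space 2 (volume : Measure Space)}

/-- Testing a field that vanishes outside a ball with transversal plane waves which have left the
ball at the final time. -/
lemma integral_planeWave_eq_zero (h : MaxwellCurve T f e D D₁ D₂ C) (hT : 0 < T) {R : ℝ}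
    (hR : 0 < R) (hfS : ∀ t ∈ Ioo 0 T, ∀ x, R < ‖x‖ → f t x = 0)
    (hD : ∀ t ∈ Icc 0 T, (∀ᵐ x, R < ‖x‖ → D t x = 0) ∧ (∀ᵐ x, R < ‖x‖ → D₁ t x = 0))
    {φ : ℝ → ℝ} (hφ : ContDiff ℝ ∞ φ) (hφc : HasCompactSupport φ) {s₀ : ℝ} (hs₀ : s₀ < T - R)
    (hφ0 : ∀ s, s₀ < s → φ s = 0) {θ p : Space} (hθ : ‖θ‖ = 1) (hp : inner ℝ θ p = 0) :
    ∫ t in 0..T, ∫ x, φ (t - inner ℝ θ x) * inner ℝ (f t x) p = 0 := by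
  have hφ1 : ContDiff ℝ ∞ (deriv φ) := hφ.deriv' (n := ∞)
  have hφ2 : ContDiff ℝ ∞ (deriv (deriv φ)) := hφ1.deriv' (n := ∞)
  have hφ10 : ∀ s, s₀ < s → deriv φ s = 0 := fun s hs => by
    have : φ =ᶠ[nhds s] fun _ => 0 := by
      filter_upwards [Ioi_mem_nhds hs] with y hy using hφ0 y hy
    rw [this.deriv_eq, deriv_const]
  -- The cutoff makes the wave square integrable. It equals one on an open set containing the closed
  -- ball of radius `R`, where the field and the source live, so it never shows.
  let κ : ContDiffBump (0 : Space) := ⟨2 * R, 3 * R, by linarith, by linarith⟩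
  have hκ : ContDiff ℝ ∞ κ := κ.contDiff
  have hκc : HasCompactSupport κ := κ.hasCompactSupport
  have hκ1 : ∀ x ∈ Metric.ball (0 : Space) (2 * R), κ x = 1 := fun x hx =>
    κ.one_of_mem_closedBall (Metric.ball_subset_closedBall hx)
  let W := fun t => (memLp_planeWave (θ := θ) (p := p) hκ hκc hφ t).toLp
  let W₁ := fun t => (memLp_planeWave (θ := θ) (p := p) hκ hκc hφ1 t).toLp
  let W₂ := fun t => (memLp_planeWave (θ := θ) (p := p) hκ hκc hφ2 t).toLp
  have hW : ∀ t, HasDerivAt W (W₁ t) t := hasDerivAt_planeWave hκ hκc hφ hφc hφ1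
  have hW₁ : ∀ t, HasDerivAt W₁ (W₂ t) t := hasDerivAt_planeWave hκ hκc hφ1 hφc.deriv hφ2
  have hφc2 : HasCompactSupport (deriv (deriv φ)) := hφc.deriv.deriv
  have hW₂ : ∀ t, HasDerivAt W₂ _ t :=
    hasDerivAt_planeWave hκ hκc hφ2 hφc2 (hφ2.deriv' (n := ∞))
  have hWc : Continuous W := continuous_iff_continuousAt.2 fun t => (hW t).continuousAt
  have hW₁c : Continuous W₁ := continuous_iff_continuousAt.2 fun t => (hW₁ t).continuousAt
  have hW₂c : Continuous W₂ := continuous_iff_continuousAt.2 fun t => (hW₂ t).continuousAt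
  have hDc : ContinuousOn D (Icc 0 T) := fun t ht => (h.hasDeriv t ht).continuousWithinAt
  have hD₁c : ContinuousOn D₁ (Icc 0 T) := fun t ht => (h.hasDeriv₁ t ht).continuousWithinAt
  -- Green's formula in time: the derivative of this bracket is `m'`, which the equation identifies
  -- with the pairing of source and wave.
  let m : ℝ → ℝ := fun t => inner ℝ (D₁ t) (W t) - inner ℝ (D t) (W₁ t)
  let m' : ℝ → ℝ := fun t => inner ℝ (D₂ t) (W t) - inner ℝ (D t) (W₂ t)
  have hm'c : ContinuousOn m' (Icc 0 T) :=
    (h.continuousOn₂.inner hWc.continuousOn).sub (hDc.inner hW₂c.continuousOn)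
  have hmc : ContinuousOn m (Icc 0 T) :=
    (hD₁c.inner hWc.continuousOn).sub (hDc.inner hW₁c.continuousOn)
  have hmd : ∀ t ∈ Ioo 0 T, HasDerivAt m (m' t) t := fun t ht => by
    have hn := Icc_mem_nhds ht.1 ht.2
    have htc := Ioo_subset_Icc_self ht
    have d1 := (h.hasDeriv t htc).hasDerivAt hn
    have d2 := (h.hasDeriv₁ t htc).hasDerivAt hn
    refine ((d2.inner ℝ (hW t)).sub (d1.inner ℝ (hW₁ t))).congr_deriv ?_
    simp only [m']
    ring
  have hftc := intervalIntegral.integral_eq_sub_of_hasDerivAt_of_le hT.le hmc hmd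
    ((hm'c.intervalIntegrable_of_Icc hT.le))
  have hm0 : m 0 = 0 := by simp only [m, h.zero, h.zero₁, inner_zero_left, sub_zero]
  have hvan : ∀ {F : Lp Space 2 (volume : Measure Space)} {ψ : ℝ → ℝ} (hψ : ContDiff ℝ ∞ ψ),
      (∀ᵐ x, R < ‖x‖ → F x = 0) → (∀ s, s₀ < s → ψ s = 0) →
      inner ℝ F ((memLp_planeWave (θ := θ) (p := p) hκ hκc hψ T).toLp) = 0 := by
    intro F ψ hψ hF hψ0
    rw [L2.inner_def]
    refine integral_eq_zero_of_ae ?_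
    filter_upwards [hF, (memLp_planeWave (θ := θ) (p := p) hκ hκc hψ T).coeFn_toLp] with x h1 h2
    rw [h2]
    by_cases hx : R < ‖x‖
    · rw [h1 hx, inner_zero_left]; rfl
    -- In the ball the phase at the final time is at least `T - R > s₀`, where the profile vanishes.
    · have h3 : inner ℝ θ x ≤ R := (real_inner_le_norm _ _).trans (by rw [hθ, one_mul]; linarith)
      rw [planeWave, hψ0 _ (by linarith), mul_zero, zero_smul, inner_zero_right]; rfl
  have hTm : T ∈ Icc 0 T := right_mem_Icc.2 hT.le
  have hmT : m T = 0 := by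
    simp only [m]
    rw [hvan hφ (hD T hTm).2 hφ0, hvan hφ1 (hD T hTm).1 hφ10, sub_zero]
  rw [hmT, hm0, sub_zero] at hftc
  refine Eq.trans ?_ hftc
  rw [intervalIntegral.integral_of_le hT.le, intervalIntegral.integral_of_le hT.le,
    integral_Ioc_eq_integral_Ioo, integral_Ioc_eq_integral_Ioo]
  refine setIntegral_congr_fun measurableSet_Ioo fun t ht => ?_
  have htc := Ioo_subset_Icc_self ht
  obtain ⟨cc, hcc, heq⟩ := h.equation t ht
  have hψs := contDiff_planeWave (θ := θ) (p := p) hκ hφ t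
  have hψc := hasCompactSupport_planeWave (θ := θ) (p := p) (φ := φ) hκc t
  -- Both curls are moved onto the smooth wave, where the wave equation turns the double curl into
  -- minus the second time derivative.
  have k1 := hcc.2.2 _ hψs hψc
  have k2 := (h.weakCurl t htc).2.2 _ (contDiff_curl hψs) (hasCompactSupport_curl hψc)
  have k3 : ∫ x, inner ℝ (D t x) (curl (curl (planeWave κ θ p φ t)) x) = -inner ℝ (D t) (W₂ t) := by
    rw [L2.inner_def, ← integral_neg]
    refine integral_congr_ae ?_
    filter_upwards [(hD t htc).1, (memLp_planeWave (θ := θ) (p := p) hκ hκc hφ2 t).coeFn_toLp]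
      with x h1 h2
    rw [h2]
    by_cases hx : R < ‖x‖
    · simp only [h1 hx, inner_zero_left, neg_zero]
    · rw [curl_curl_planeWave hφ hθ hp Metric.isOpen_ball hκ1 t
        (mem_ball_zero_iff.2 (by linarith)), inner_neg_right]
  have k4 : inner ℝ (D₂ t) (W t) = ∫ x, inner ℝ (D₂ t x) (planeWave κ θ p φ t x) := by
    rw [L2.inner_def]
    refine integral_congr_ae ?_
    filter_upwards [(memLp_planeWave (θ := θ) (p := p) hκ hκc hφ t).coeFn_toLp] with x h2
    rw [h2]
  have i1 : Integrable (fun x => inner ℝ (D₂ t x) (planeWave κ θ p φ t x)) volume :=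
    (Lp.memLp (D₂ t)).integrable_inner' (memLp_planeWave hκ hκc hφ t)
  have i2 : Integrable (fun x => inner ℝ (cc x) (planeWave κ θ p φ t x)) volume :=
    hcc.2.1.integrable_inner_of_hasCompactSupport hψs.continuous hψc
  have k5 : m' t = ∫ x, inner ℝ (f t x) (planeWave κ θ p φ t x) := by
    have : m' t = inner ℝ (D₂ t) (W t) + ∫ x, inner ℝ (cc x) (planeWave κ θ p φ t x) := by
      rw [k1, k2, k3, ← sub_eq_add_neg]
    rw [this, k4, ← integral_add i1 i2]
    refine integral_congr_ae ?_
    filter_upwards [heq] with x hx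
    rw [← inner_add_left, hx]
  rw [k5]
  congr 1 with x
  by_cases hx : R < ‖x‖
  · rw [hfS t ht x hx, inner_zero_left, inner_zero_left, mul_zero]
  · rw [planeWave, hκ1 x (mem_ball_zero_iff.2 (by linarith)), one_mul, real_inner_smul_right]

end MaxwellCurve

/-! ### Injectivity of Laplace transforms by Stone–Weierstrass. -/

/-- A continuous function on a compact space orthogonal to a multiplicatively closed family of
continuous functions that separates points vanishes almost everywhere. -/
lemma ae_eq_zero_of_forall_integral_mul {X : Type*} [TopologicalSpace X] [CompactSpace X]
    [MeasurableSpace X] [BorelSpace X] {ν : Measure X} [IsFiniteMeasure ν]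
    (M : Submonoid C(X, ℝ)) (hM : ∀ x y : X, x ≠ y → ∃ k ∈ M, k x ≠ k y) (f : C(X, ℝ))
    (h : ∀ k ∈ M, ∫ x, f x * k x ∂ν = 0) : ∀ᵐ x ∂ν, f x = 0 := by
  let A : Subalgebra ℝ C(X, ℝ) := Algebra.adjoin ℝ (M : Set C(X, ℝ))
  have hA : A.SeparatesPoints := fun x y hxy => by
    obtain ⟨k, hk, hne⟩ := hM x y hxy
    exact ⟨k, ⟨k, Algebra.subset_adjoin hk, rfl⟩, hne⟩
  have hint : ∀ k : C(X, ℝ), Integrable (fun x => f x * k x) ν := fun k =>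
    (f * k).continuous.integrable_of_hasCompactSupport (HasCompactSupport.of_compactSpace _)
  have hspan : ∀ k ∈ Submodule.span ℝ (M : Set C(X, ℝ)), ∫ x, f x * k x ∂ν = 0 := fun k hk => by
    induction hk using Submodule.span_induction with
    | mem k hk => exact h k hk
    | zero => simp
    | add k l _ _ h1 h2 =>
      have := integral_add (hint k) (hint l)
      simp only [ContinuousMap.add_apply, mul_add]
      rw [this, h1, h2, add_zero]
    | smul r k _ h1 =>
      simp only [ContinuousMap.smul_apply, smul_eq_mul, mul_left_comm _ r]
      rw [integral_const_mul, h1, mul_zero]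
  have hAspan : ∀ k ∈ A, k ∈ Submodule.span ℝ (M : Set C(X, ℝ)) := fun k hk => by
    have := Algebra.adjoin_eq_span ℝ (M : Set C(X, ℝ))
    rw [Submonoid.closure_eq] at this
    rw [← this]; exact hk
  have hdense := ContinuousMap.subalgebra_topologicalClosure_eq_top_of_separatesPoints A hA
  have hcont : Continuous fun k : C(X, ℝ) => ∫ x, f x * k x ∂ν := by
    refine continuous_iff_continuousAt.2 fun k => ?_
    have hle : ∀ l : C(X, ℝ), ‖(∫ x, f x * l x ∂ν) - ∫ x, f x * k x ∂ν‖
        ≤ ‖f‖ * ‖l - k‖ * ν.real univ := fun l => by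
      rw [← integral_sub (hint l) (hint k), mul_comm (‖f‖ * _)]
      refine (norm_integral_le_of_norm_le_const (C := ‖f‖ * ‖l - k‖)
        (Filter.Eventually.of_forall fun x => ?_)).trans (le_of_eq (mul_comm _ _))
      rw [← mul_sub, norm_mul]
      exact mul_le_mul (f.norm_coe_le_norm x) ((l - k).norm_coe_le_norm x) (norm_nonneg _)
        (norm_nonneg _)
    rw [ContinuousAt, tendsto_iff_norm_sub_tendsto_zero]
    refine squeeze_zero (fun _ => norm_nonneg _) hle ?_
    have : Filter.Tendsto (fun l : C(X, ℝ) => ‖f‖ * ‖l - k‖ * ν.real univ) (nhds k)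
        (nhds (‖f‖ * ‖k - k‖ * ν.real univ)) :=
      ((continuous_const.mul (continuous_id.sub continuous_const).norm).mul
        continuous_const).tendsto k
    simpa using this
  have hall : ∫ x, f x * f x ∂ν = 0 := by
    have hcl : IsClosed {k : C(X, ℝ) | ∫ x, f x * k x ∂ν = 0} := isClosed_eq hcont continuous_const
    have hmem : f ∈ closure (A : Set C(X, ℝ)) := by
      have : f ∈ A.topologicalClosure := by rw [hdense]; trivial
      exact this
    exact closure_minimal (fun k hk => hspan k (hAspan k hk)) hcl hmem
  have := (integral_eq_zero_iff_of_nonneg (fun x => mul_self_nonneg (f x)) (hint f)).1 hall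
  filter_upwards [this] with x hx using mul_self_eq_zero.1 hx

/-- The version of `ae_eq_zero_of_forall_integral_mul` for a compact subset. -/
lemma ae_eq_zero_of_forall_setIntegral_mul {E : Type*} [TopologicalSpace E]
    [MeasurableSpace E] [BorelSpace E] {μ : Measure E} [IsLocallyFiniteMeasure μ] {K : Set E}
    (hK : IsCompact K) (hKm : MeasurableSet K) {ι : Type*} (m : ι → E → ℝ)
    (hm : ∀ i, ContinuousOn (m i) K) (h1 : ∃ i, ∀ x ∈ K, m i x = 1)
    (hmul : ∀ i j, ∃ k, ∀ x ∈ K, m k x = m i x * m j x)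
    (hsep : ∀ x ∈ K, ∀ y ∈ K, x ≠ y → ∃ i, m i x ≠ m i y) {f : E → ℝ} (hf : ContinuousOn f K)
    (h : ∀ i, ∫ x in K, f x * m i x ∂μ = 0) : ∀ᵐ x ∂(μ.restrict K), f x = 0 := by
  have : CompactSpace K := isCompact_iff_compactSpace.1 hK
  have : IsFiniteMeasure (μ.comap ((↑) : K → E)) := ⟨by
    rw [Measure.comap_apply _ Subtype.val_injective
      (fun s hs => (MeasurableEmbedding.subtype_coe hKm).measurableSet_image.2 hs) _ MeasurableSet.univ]
    simpa using hK.measure_lt_top⟩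
  let M : Submonoid C(K, ℝ) :=
    { carrier := {k | ∃ i, ∀ x : K, k x = m i x}
      one_mem' := by
        obtain ⟨i, hi⟩ := h1
        exact ⟨i, fun x => (hi x x.2).symm⟩
      mul_mem' := by
        rintro a b ⟨i, hi⟩ ⟨j, hj⟩
        obtain ⟨k, hk⟩ := hmul i j
        exact ⟨k, fun x => by rw [ContinuousMap.mul_apply, hi, hj, hk x x.2]⟩ }
  have key := ae_eq_zero_of_forall_integral_mul (ν := μ.comap ((↑) : K → E)) M ?_
    ⟨K.domRestrict f, continuousOn_iff_continuous_domRestrict.1 hf⟩ ?_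
  · have e1 := (MeasurableEmbedding.subtype_coe hKm).map_comap μ
    rw [Subtype.range_coe] at e1
    rw [← e1]
    exact ((MeasurableEmbedding.subtype_coe hKm).ae_map_iff).2 key
  · intro x y hxy
    obtain ⟨i, hi⟩ := hsep x x.2 y y.2 fun h => hxy (Subtype.ext h)
    exact ⟨⟨K.domRestrict (m i), continuousOn_iff_continuous_domRestrict.1 (hm i)⟩,
      ⟨i, fun _ => rfl⟩, hi⟩
  · rintro k ⟨i, hi⟩
    simp only [hi]
    exact (integral_subtype_comap hKm (fun x => f x * m i x)).trans (h i)

section Laplace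

variable {E : Type*} [NormedAddCommGroup E] [InnerProductSpace ℝ E] [MeasurableSpace E]
  {μ : Measure E}

/-- The two-sided Laplace transform. -/
def laplace (μ : Measure E) (f : E → ℝ) (ξ : E) : ℝ := ∫ y, f y * Real.exp (-inner ℝ ξ y) ∂μ

lemma laplace_eq_setIntegral {f : E → ℝ} (ξ : E) :
    laplace μ f ξ = ∫ y in tsupport f, f y * Real.exp (-inner ℝ ξ y) ∂μ := by
  rw [laplace, setIntegral_eq_integral_of_forall_compl_eq_zero]
  intro x hx
  rw [image_eq_zero_of_notMem_tsupport hx, zero_mul]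

lemma continuous_laplace [BorelSpace E] [IsFiniteMeasureOnCompacts μ] [SecondCountableTopology E] [LocallyCompactSpace E] {f : E → ℝ}
    (hf : Continuous f) (hc : HasCompactSupport f) : Continuous (laplace μ f) := by
  have : laplace μ f = fun ξ => ∫ y in tsupport f, f y * Real.exp (-inner ℝ ξ y) ∂μ := by
    ext ξ; exact laplace_eq_setIntegral ξ
  rw [this]
  refine continuous_parametric_integral_of_continuous ?_ hc
  fun_prop

/-- The exponentials `exp(-ξ·y)` contain `1`, are closed under products and separate points, so a
function orthogonal to all of them on its support is zero. -/
lemma exists_laplace_ne_zero [BorelSpace E] [IsLocallyFiniteMeasure μ] [μ.IsOpenPosMeasure] [ProperSpace E] {f : E → ℝ} (hf : Continuous f)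
    (hc : HasCompactSupport f) (h0 : f ≠ 0) : ∃ ξ, laplace μ f ξ ≠ 0 := by
  by_contra! hcon
  have := ae_eq_zero_of_forall_setIntegral_mul (μ := μ) (K := tsupport f) hc hc.measurableSet
    (fun ξ y => Real.exp (-inner ℝ ξ y)) (fun ξ => by fun_prop) ⟨0, fun x _ => by simp⟩
    (fun ξ ζ => ⟨ξ + ζ, fun x _ => by rw [← Real.exp_add, inner_add_left]; congr 1; ring⟩)
    (fun x _ y _ hxy => ?_) hf.continuousOn fun ξ => by rw [← laplace_eq_setIntegral, hcon]
  · have h2 : ∀ᵐ x ∂μ, f x = 0 := by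
      rw [ae_restrict_iff' hc.measurableSet] at this
      filter_upwards [this] with x hx
      by_cases h : x ∈ tsupport f
      · exact hx h
      · exact image_eq_zero_of_notMem_tsupport h
    exact h0 ((hf.ae_eq_iff_eq μ continuous_const).1 h2)
  · by_contra! hall
    refine hxy ?_
    refine ext_inner_left ℝ fun ξ => ?_
    have := Real.exp_injective (hall ξ)
    linarith

end Laplace

/-- The Laplace transform on a compact interval determines a continuous function, already by its
values on an open interval. -/
lemma eqOn_zero_of_integral_mul_exp {T₀ : ℝ} (hT₀ : 0 < T₀) {G : ℝ → ℝ}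
    (hG : ContinuousOn G (Icc 0 T₀)) {c d : ℝ} (hcd : c < d)
    (h : ∀ l ∈ Ioo c d, ∫ t in 0..T₀, G t * Real.exp (l * t) = 0) : ∀ t ∈ Icc 0 T₀, G t = 0 := by
  -- Each derivative in `l` brings down a power of `t`, so all moments of `G t * exp (l t)` vanish
  -- at any fixed `l` of the interval; monomials are dense on `[0, T₀]`.
  have hmom : ∀ n : ℕ, ∀ l ∈ Ioo c d, ∫ t in 0..T₀, (G t * t ^ n) * Real.exp (l * t) = 0 := by
    intro n
    induction n with
    | zero => simpa using h
    | succ n ih =>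
      intro l hl
      have hGn : ContinuousOn (fun t => G t * t ^ n) (uIcc 0 T₀) := by
        rw [uIcc_of_le hT₀.le]; exact hG.mul (continuous_pow n).continuousOn
      have hGn' : ContinuousOn (fun t => G t * t ^ (n + 1)) (uIcc 0 T₀) := by
        rw [uIcc_of_le hT₀.le]; exact hG.mul (continuous_pow (n + 1)).continuousOn
      have hderiv := (intervalIntegral.hasDerivAt_integral_of_dominated_loc_of_deriv_le
        (μ := volume) (a := 0) (b := T₀) (s := Ioo c d)
        (F := fun l t => (G t * t ^ n) * Real.exp (l * t))
        (F' := fun l t => (G t * t ^ (n + 1)) * Real.exp (l * t)) (x₀ := l)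
        (bound := fun t => |G t * t ^ (n + 1)| * Real.exp ((|c| + |d|) * T₀))
        (Ioo_mem_nhds hl.1 hl.2) ?_ ?_ ?_ ?_ ?_ ?_).2
      · have e : (fun l => ∫ t in 0..T₀, (G t * t ^ n) * Real.exp (l * t)) =ᶠ[nhds l]
            fun _ => (0 : ℝ) := by
          filter_upwards [Ioo_mem_nhds hl.1 hl.2] with y hy using ih y hy
        rw [← hderiv.deriv, e.deriv_eq, deriv_const]
      · refine Filter.Eventually.of_forall fun y => ?_
        exact (intervalIntegrable_iff.1 (hGn.mul (g := fun t => Real.exp (y * t))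
          (by fun_prop)).intervalIntegrable).aestronglyMeasurable
      · exact (hGn.mul (by fun_prop)).intervalIntegrable
      · exact (intervalIntegrable_iff.1 (hGn'.mul (g := fun t => Real.exp (l * t))
          (by fun_prop)).intervalIntegrable).aestronglyMeasurable
      · refine Filter.Eventually.of_forall fun t ht y hy => ?_
        rw [uIoc_of_le hT₀.le] at ht
        rw [norm_mul, Real.norm_eq_abs, Real.norm_of_nonneg (Real.exp_nonneg _)]
        refine mul_le_mul_of_nonneg_left (Real.exp_le_exp.2 ?_) (abs_nonneg _)
        have hyl : y ≤ |c| + |d| := by linarith [hy.2, le_abs_self d, abs_nonneg c]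
        calc y * t ≤ (|c| + |d|) * t := mul_le_mul_of_nonneg_right hyl ht.1.le
          _ ≤ (|c| + |d|) * T₀ := mul_le_mul_of_nonneg_left ht.2 (by positivity)
      · exact ((hGn'.abs).mul continuousOn_const).intervalIntegrable
      · refine Filter.Eventually.of_forall fun t _ y _ => ?_
        have e1 : HasDerivAt (fun y : ℝ => Real.exp (y * t)) (Real.exp (y * t) * (1 * t)) y :=
          ((hasDerivAt_id y).mul_const t).exp
        refine (e1.const_mul (G t * t ^ n)).congr_deriv ?_
        ring
  obtain ⟨l, hl⟩ : (Ioo c d).Nonempty := nonempty_Ioo.2 hcd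
  have key := ae_eq_zero_of_forall_setIntegral_mul (μ := (volume : Measure ℝ)) (K := Icc 0 T₀)
    isCompact_Icc measurableSet_Icc (fun (n : ℕ) (t : ℝ) => t ^ n)
    (fun n => (continuous_pow n).continuousOn) ⟨0, fun x _ => pow_zero x⟩
    (fun i j => ⟨i + j, fun x _ => pow_add x i j⟩) (fun x _ y _ hxy => ⟨1, by simpa using hxy⟩)
    (f := fun t => G t * Real.exp (l * t)) (hG.mul (by fun_prop)) fun n => by
      have e : ∀ t, G t * Real.exp (l * t) * t ^ n = G t * t ^ n * Real.exp (l * t) :=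
        fun t => by ring
      simp only [e]
      rw [integral_Icc_eq_integral_Ioc, ← intervalIntegral.integral_of_le hT₀.le, hmom n l hl]
  have hae : G =ᵐ[volume.restrict (Icc 0 T₀)] fun _ => 0 := by
    filter_upwards [key] with t ht
    exact (mul_eq_zero.1 ht).resolve_right (Real.exp_ne_zero _)
  exact Measure.eqOn_Icc_of_ae_eq volume hT₀.ne hae hG continuousOn_const

/-! ### Support and Laplace transform of the moving source. -/

/-- The point of `ℝ³` with given planar part and third coordinate. -/
def combine (y : Plane) (z : ℝ) : Space := !₂[y 0, y 1, z]

lemma inner_eq_planePart (ξ x : Space) :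
    inner ℝ ξ x = inner ℝ (planePart ξ) (planePart x) + inner ℝ (ξ 2) (x 2) := by
  simp only [PiLp.inner_apply, Fin.sum_univ_three, Fin.sum_univ_two, planePart]
  simp

lemma planePart_combine (y : Plane) (z : ℝ) : planePart (combine y z) = y := by
  ext i; fin_cases i <;> simp [planePart, combine]

lemma combine_two (y : Plane) (z : ℝ) : combine y z 2 = z := by simp [combine]

lemma norm_sq_eq_planePart (x : Space) : ‖x‖ ^ 2 = ‖planePart x‖ ^ 2 + x 2 ^ 2 := by
  rw [← real_inner_self_eq_norm_sq, ← real_inner_self_eq_norm_sq, inner_eq_planePart]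
  simp [sq]

lemma continuous_planePart : Continuous planePart := by
  unfold planePart
  refine (PiLp.continuous_toLp 2 _).comp (continuous_pi fun i => ?_)
  fin_cases i <;> simp <;> fun_prop

/-- Fubini for the splitting of `ℝ³` into a plane and a line. -/
lemma integral_planePart_mul (A : Plane → ℝ) (B : ℝ → ℝ) :
    ∫ x : Space, A (planePart x) * B (x 2) = (∫ y, A y) * ∫ z, B z := by
  have h1 : ∫ x : Space, A (planePart x) * B (x 2) =
      ∫ x : Fin 3 → ℝ, A (planePart (WithLp.toLp 2 x)) * B (x 2) := by
    rw [← (EuclideanSpace.volume_preserving_symm_measurableEquiv_toLp (Fin 3)).symm.integral_comp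
      (MeasurableEquiv.measurableEmbedding _)]
    rfl
  have h2 := (volume_preserving_piFinSuccAbove (fun _ : Fin 3 => ℝ) 2).integral_comp
    (MeasurableEquiv.measurableEmbedding _)
    (fun q : ℝ × (Fin 2 → ℝ) => B q.1 * A (WithLp.toLp 2 q.2))
  have h3 : ∀ x : Fin 3 → ℝ, A (planePart (WithLp.toLp 2 x)) * B (x 2) =
      B (MeasurableEquiv.piFinSuccAbove (fun _ : Fin 3 => ℝ) 2 x).1
        * A (WithLp.toLp 2 (MeasurableEquiv.piFinSuccAbove (fun _ : Fin 3 => ℝ) 2 x).2) := fun x => by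
    rw [mul_comm]
    congr 2
    ext i
    fin_cases i <;> rfl
  have h4 : ∫ y : Plane, A y = ∫ y : Fin 2 → ℝ, A (WithLp.toLp 2 y) := by
    rw [← (EuclideanSpace.volume_preserving_symm_measurableEquiv_toLp (Fin 2)).symm.integral_comp
      (MeasurableEquiv.measurableEmbedding _)]
    rfl
  rw [h1, h4]
  simp only [h3]
  refine h2.trans ?_
  rw [Measure.volume_eq_prod, mul_comm]
  exact integral_prod_mul B fun q : Fin 2 → ℝ => A (WithLp.toLp 2 q)

lemma inner_source (J : Plane → Plane) (h g : ℝ → ℝ) (a : ℝ → Plane) (t : ℝ) (x p : Space) :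
    inner ℝ (source J h g a t x) p =
      g t * (h (x 2) * inner ℝ (J (planePart x - a t)) (planePart p)) := by
  simp only [source, PiLp.inner_apply, Fin.sum_univ_three, Fin.sum_univ_two,
    planePart]
  simp
  ring

lemma continuous_source {J : Plane → Plane} {h : ℝ → ℝ} (hJ : Continuous J) (hh : Continuous h)
    (g : ℝ → ℝ) (a : ℝ → Plane) (t : ℝ) : Continuous (source J h g a t) := by
  have h1 : Continuous fun x : Space => J (planePart x - a t) :=
    hJ.comp (f := fun x => planePart x - a t) (continuous_planePart.sub continuous_const)
  have h2 : Continuous fun x : Space => h (x 2) := hh.comp (f := fun x : Space => x 2) (by fun_prop)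
  have h3 : Continuous fun x : Space =>
      (!₂[J (planePart x - a t) 0, J (planePart x - a t) 1, 0] : Space) := by
    refine (PiLp.continuous_toLp 2 fun _ : Fin 3 => ℝ).comp (continuous_pi fun i => ?_)
    fin_cases i
    · exact (EuclideanSpace.proj (𝕜 := ℝ) (0 : Fin 2)).continuous.comp h1
    · exact (EuclideanSpace.proj (𝕜 := ℝ) (1 : Fin 2)).continuous.comp h1
    · exact continuous_const
  exact Continuous.smul (h2.mul continuous_const) h3

lemma norm_sq_lt_of_source_ne_zero {J : Plane → Plane} {h g : ℝ → ℝ} {a : ℝ → Plane} {m R₁ t : ℝ}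
    (hJ : tsupport J ⊆ Metric.ball 0 m) (hh : tsupport h ⊆ Ioo (-m) m) (ha : ‖a t‖ ≤ R₁)
    {x : Space} (hx : source J h g a t x ≠ 0) : ‖x‖ ^ 2 < (m + R₁) ^ 2 + m ^ 2 := by
  have h1 : J (planePart x - a t) ≠ 0 := fun h0 => hx (by
    ext i; fin_cases i <;> simp [source, h0])
  have h2 : h (x 2) ≠ 0 := fun h0 => hx (by simp [source, h0])
  have h3 := hJ (subset_tsupport _ h1)
  have h4 := hh (subset_tsupport _ h2)
  rw [mem_ball_zero_iff] at h3
  have h5 : ‖planePart x‖ < m + R₁ := by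
    have := norm_add_le (planePart x - a t) (a t)
    rw [sub_add_cancel] at this
    linarith
  rw [norm_sq_eq_planePart]
  have h6 := norm_nonneg (planePart x)
  have h7 : x 2 ^ 2 < m ^ 2 := sq_lt_sq' h4.1 h4.2
  nlinarith

/-- The Laplace transform of the longitudinal part of a divergence free field vanishes. -/
lemma DivFree.laplace_inner_eq_zero {J : Plane → Plane} (hdiv : DivFree J) {m : ℝ} (hm : 0 < m)
    (hJ : tsupport J ⊆ Metric.ball 0 m) (ξ : Plane) :
    laplace volume (fun y => inner ℝ (J y) ξ) ξ = 0 := by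
  -- Made compactly supported by a bump equal to one on the support of `J`, the function `exp(-ξ·y)`
  -- is an admissible test function, and its gradient there is `-ξ exp(-ξ·y)`.
  let κ : ContDiffBump (0 : Plane) := ⟨m, 2 * m, hm, by linarith⟩
  have hκ : ContDiff ℝ ∞ κ := κ.contDiff
  have hκc : HasCompactSupport κ := κ.hasCompactSupport
  have hexp : ContDiff ℝ ∞ fun y : Plane => Real.exp (-inner ℝ ξ y) :=
    Real.contDiff_exp.comp (contDiff_const.inner ℝ contDiff_id).neg
  have h0 := hdiv (fun y => κ y * Real.exp (-inner ℝ ξ y)) (hκ.mul hexp) hκc.mul_right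
  rw [laplace, ← neg_eq_zero, ← integral_neg, ← h0]
  congr 1 with y
  by_cases hy : J y = 0
  · simp [hy]
  · have hyb := hJ (subset_tsupport _ hy)
    have e : (fun y => κ y * Real.exp (-inner ℝ ξ y)) =ᶠ[nhds y]
        fun y => Real.exp (-inner ℝ ξ y) := by
      filter_upwards [Metric.isOpen_ball.mem_nhds hyb] with z hz
      rw [κ.one_of_mem_closedBall (Metric.ball_subset_closedBall hz), one_mul]
    have e1 : HasFDerivAt (fun y : Plane => -inner ℝ ξ y) (-innerSL ℝ ξ) y := 
      ((innerSL ℝ ξ).hasFDerivAt (x := y)).neg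
    rw [e.fderiv_eq, e1.exp.fderiv]
    simp [real_inner_comm]
    ring

/-- The smooth cutoff of an exponential to a half line, compactly supported. -/
lemma exists_cutoff_exp (l : ℝ) {s₀ s₁ s₂ : ℝ} (h12 : s₁ < s₂) : ∃ φ : ℝ → ℝ,
    ContDiff ℝ ∞ φ ∧ HasCompactSupport φ ∧ (∀ s, s₂ < s → φ s = 0) ∧
      ∀ s, s₀ ≤ s → s ≤ s₁ → φ s = Real.exp (l * s) := by
  refine ⟨fun s => Real.smoothTransition (s - (s₀ - 1)) * Real.smoothTransition ((s₂ - s) / (s₂ - s₁))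
    * Real.exp (l * s), ?_, ?_, fun s hs => ?_, fun s h0 h1 => ?_⟩
  · refine ((Real.smoothTransition.contDiff.comp (contDiff_id.sub contDiff_const)).mul
      (Real.smoothTransition.contDiff.comp ((contDiff_const.sub contDiff_id).div_const _))).mul
      (Real.contDiff_exp.comp (contDiff_const.mul contDiff_id))
  · refine HasCompactSupport.intro (isCompact_Icc (a := s₀ - 1) (b := s₂)) fun s hs => ?_
    rw [mem_Icc, not_and_or, not_le, not_le] at hs
    rcases hs with hs | hs
    · rw [Real.smoothTransition.zero_of_nonpos (by linarith), zero_mul, zero_mul]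
    · rw [Real.smoothTransition.zero_of_nonpos (x := (s₂ - s) / (s₂ - s₁)), mul_zero, zero_mul]
      exact div_nonpos_of_nonpos_of_nonneg (by linarith) (by linarith)
  · simp only []
    rw [Real.smoothTransition.zero_of_nonpos (x := (s₂ - s) / (s₂ - s₁)), mul_zero, zero_mul]
    exact div_nonpos_of_nonpos_of_nonneg (by linarith) (by linarith)
  · simp only []
    rw [Real.smoothTransition.one_of_one_le (by linarith), Real.smoothTransition.one_of_one_le,
      one_mul, one_mul]
    rw [le_div_iff₀ (by linarith)]
    linarith

/-- The pairing of a moving source with an exponential plane wave. -/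
lemma integral_exp_mul_inner_source (J : Plane → Plane) (h g : ℝ → ℝ) (a : ℝ → Plane)
    (t : ℝ) (ξ p : Space) :
    ∫ x, Real.exp (-inner ℝ ξ x) * inner ℝ (source J h g a t x) p =
      g t * (Real.exp (-inner ℝ (planePart ξ) (a t)) *
        laplace volume (fun y => inner ℝ (J y) (planePart p)) (planePart ξ) *
        laplace volume h (ξ 2)) := by
  have h1 : ∀ x : Space, Real.exp (-inner ℝ ξ x) * inner ℝ (source J h g a t x) p =
      g t * ((inner ℝ (J (planePart x - a t)) (planePart p) *
        Real.exp (-inner ℝ (planePart ξ) (planePart x))) *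
        (h (x 2) * Real.exp (-inner ℝ (ξ 2) (x 2)))) := fun x => by
    rw [inner_source, inner_eq_planePart, neg_add, Real.exp_add]
    ring
  simp only [h1]
  rw [integral_const_mul, integral_planePart_mul
    (fun y => inner ℝ (J (y - a t)) (planePart p) * Real.exp (-inner ℝ (planePart ξ) y))
    (fun z => h z * Real.exp (-inner ℝ (ξ 2) z))]
  have h2 : ∫ y, inner ℝ (J (y - a t)) (planePart p) * Real.exp (-inner ℝ (planePart ξ) y) =
      Real.exp (-inner ℝ (planePart ξ) (a t)) *
        laplace volume (fun y => inner ℝ (J y) (planePart p)) (planePart ξ) := by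
    rw [laplace, ← integral_const_mul, ← integral_add_right_eq_self _ (a t)]
    congr 1 with y
    rw [add_sub_cancel_right, inner_add_right, neg_add, Real.exp_add]
    ring
  rw [h2, laplace, laplace]

/-- At each time the source lies in a cylinder of radius `m + R₁` and half height `m`. With `2m² =
Rhat²` and `m < Rhat`, `(m + R₁)² + m² = Rhat² + 2mR₁ + R₁² < (Rhat + R₁)²`. The strict gap is the
room later used to switch off the wave profile. -/
lemma exists_source_radius {Rhat R₁ T₀ : ℝ} (hRhat : 0 < Rhat) (hR₁ : 0 < R₁) {J : Plane → Plane}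
    {h g : ℝ → ℝ} (hJsupp : tsupport J ⊆ Metric.ball 0 (Rhat * √2 / 2))
    (hhsupp : tsupport h ⊆ Ioo (-(Rhat * √2 / 2)) (Rhat * √2 / 2))
    (hgT₀ : ∀ t ≥ T₀, g t = 0) :
    ∃ r, r < Rhat + R₁ ∧ ∀ a : ℝ → Plane, (∀ t ∈ Icc 0 T₀, ‖a t‖ ≤ R₁) →
      ∀ t, 0 < t → ∀ x, r < ‖x‖ → source J h g a t x = 0 := by
  set m := Rhat * √2 / 2 with hm
  have h2 : √2 * √2 = 2 := Real.mul_self_sqrt (by norm_num)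
  have hm0 : 0 < m := by positivity
  have hmm : m ^ 2 = Rhat ^ 2 / 2 := by
    rw [hm]
    calc (Rhat * √2 / 2) ^ 2 = Rhat ^ 2 * (√2 * √2) / 4 := by ring
      _ = Rhat ^ 2 / 2 := by rw [h2]; ring
  refine ⟨√((m + R₁) ^ 2 + m ^ 2), ?_, fun a ha t ht x hx => ?_⟩
  · rw [Real.sqrt_lt' (by positivity)]
    have hmR : m < Rhat := lt_of_pow_lt_pow_left₀ 2 hRhat.le (by rw [hmm]; nlinarith)
    nlinarith
  · by_contra hne
    rcases le_or_gt T₀ t with h0 | h0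
    · exact hne (by simp [source, hgT₀ t h0])
    · have := norm_sq_lt_of_source_ne_zero hJsupp hhsupp (ha t ⟨ht.le, h0.le⟩) hne
      rw [Real.sqrt_lt' (lt_of_le_of_lt (Real.sqrt_nonneg _) hx)] at hx
      linarith

lemma covCross_eq_zero_of_crossProduct_eq {x u v : Space} {R : ℝ} (hR : 0 < R)
    (h : crossProduct u.ofLp (R⁻¹ • x).ofLp = crossProduct v.ofLp (R⁻¹ • x).ofLp) :
    covCross (innerSL ℝ x) (u - v) = 0 := by
  have hR' : R⁻¹ ≠ 0 := inv_ne_zero hR.ne'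
  rw [cross_apply, cross_apply] at h
  have h0 := congrFun h 0
  have h1 := congrFun h 1
  have h2 := congrFun h 2
  simp at h0 h1 h2
  have k0 := (mul_eq_zero.1 (show R⁻¹ * (x 1 * (u 2 - v 2) - x 2 * (u 1 - v 1)) = 0 by
    linarith)).resolve_left hR'
  have k1 := (mul_eq_zero.1 (show R⁻¹ * (x 2 * (u 0 - v 0) - x 0 * (u 2 - v 2)) = 0 by
    linarith)).resolve_left hR'
  have k2 := (mul_eq_zero.1 (show R⁻¹ * (x 0 * (u 1 - v 1) - x 1 * (u 0 - v 0)) = 0 by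
    linarith)).resolve_left hR'
  rw [covCross_apply]
  ext i
  fin_cases i <;> simp [EuclideanSpace.inner_single_right] <;> assumption

/-! ### Recovery of the orbit. -/

variable {R T₀ T : ℝ} {J : Plane → Plane} {h g : ℝ → ℝ} {a b : ℝ → Plane}

/-- The pairing of a compactly supported moving source with a plane wave whose profile is an
exponential on the range of arguments that matters. -/
lemma integral_wave_mul_inner_source {r l t : ℝ} (hl : l ≠ 0) (hJ : Continuous J)
    (hh : Continuous h) (hgT₀ : ∀ t ≥ T₀, g t = 0) (ht : 0 < t)
    (hsrc : ∀ x, r < ‖x‖ → source J h g a t x = 0) {φ : ℝ → ℝ}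
    (hφ : ∀ s, -r ≤ s → s ≤ T₀ + r → φ s = Real.exp (l * s)) {ξ : Space} (hξ : ‖l⁻¹ • ξ‖ = 1)
    (p : Space) :
    Integrable (fun x => φ (t - inner ℝ (l⁻¹ • ξ) x) * inner ℝ (source J h g a t x) p) volume ∧
    ∫ x, φ (t - inner ℝ (l⁻¹ • ξ) x) * inner ℝ (source J h g a t x) p =
      Real.exp (l * t) * (g t * (Real.exp (-inner ℝ (planePart ξ) (a t)) *
        laplace volume (fun y => inner ℝ (J y) (planePart p)) (planePart ξ) *
        laplace volume h (ξ 2))) := by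
  have hpt : ∀ x, φ (t - inner ℝ (l⁻¹ • ξ) x) * inner ℝ (source J h g a t x) p =
      Real.exp (l * t) * (Real.exp (-inner ℝ ξ x) * inner ℝ (source J h g a t x) p) := fun x => by
    by_cases hx : source J h g a t x = 0
    · simp [hx]
    · have hxr : ‖x‖ ≤ r := not_lt.1 fun h' => hx (hsrc x h')
      have htT : t ≤ T₀ := by
        by_contra! h'
        exact hx (by simp [source, hgT₀ t h'.le])
      -- On the support `|θ·x| ≤ r` and `0 < t ≤ T₀`, so the phase stays in `[-r, T₀ + r]`, where
      -- the profile is exponential.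
      have hin := abs_le.1 (abs_real_inner_le_norm (l⁻¹ • ξ) x)
      rw [hξ, one_mul] at hin
      rw [hφ _ (by linarith) (by linarith), real_inner_smul_left, ← mul_assoc, ← Real.exp_add]
      congr 2
      field_simp
      ring
  have hint : Integrable (fun x => Real.exp (-inner ℝ ξ x) * inner ℝ (source J h g a t x) p)
      volume := by
    refine Continuous.integrable_of_hasCompactSupport ?_ ?_
    · have := continuous_source hJ hh g a t
      fun_prop
    · refine HasCompactSupport.intro (isCompact_closedBall (0 : Space) r) fun x hx => ?_
      rw [hsrc x (by simpa using hx), inner_zero_left, mul_zero]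
  simp only [hpt]
  refine ⟨hint.const_mul _, ?_⟩
  rw [integral_const_mul, integral_exp_mul_inner_source]

/-- The temporal integral obtained by testing the difference of two moving sources with plane
waves. -/
lemma laplace_mul_laplace_mul_integral_eq_zero {r l : ℝ} (hl : 0 < l) (hT₀ : 0 < T₀)
    (hTT : T₀ ≤ T) (hrR : r < T - R - T₀) (hR : 0 < R) (hrR' : r ≤ R)
    (hJ : Continuous J) (hh : Continuous h) (hgT₀ : ∀ t ≥ T₀, g t = 0)
    (hJdiv : DivFree J) {m : ℝ} (hm : 0 < m) (hJsupp : tsupport J ⊆ Metric.ball 0 m)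
    (hsa : ∀ t, 0 < t → ∀ x, r < ‖x‖ → source J h g a t x = 0)
    (hsb : ∀ t, 0 < t → ∀ x, r < ‖x‖ → source J h g b t x = 0)
    {e : ℝ → Space → Space} {D D₁ D₂ C : ℝ → Lp Space 2 (volume : Measure Space)}
    (hM : MaxwellCurve T (fun t x => source J h g a t x - source J h g b t x) e D D₁ D₂ C)
    (hD : ∀ t ∈ Icc 0 T, (∀ᵐ x, R < ‖x‖ → D t x = 0) ∧ (∀ᵐ x, R < ‖x‖ → D₁ t x = 0))
    {ξ : Plane} {ζ : ℝ} (hlξ : ‖ξ‖ ^ 2 + ζ ^ 2 = l ^ 2) (i : Fin 2) :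
    laplace volume (fun y => J y i) ξ * laplace volume h ζ *
      ∫ t in 0..T₀, (g t * (Real.exp (-inner ℝ ξ (a t)) - Real.exp (-inner ℝ ξ (b t)))) *
        Real.exp (l * t) = 0 := by
  -- The profile is switched off between `T₀ + r` and the midpoint of `T₀ + r` and `T - R`.
  obtain ⟨φ, hφ, hφc, hφ0, hφe⟩ := exists_cutoff_exp l (s₀ := -r)
    (show T₀ + r < (T₀ + r + (T - R)) / 2 by linarith)
  let Ξ : Space := combine ξ ζ
  have hΞ : planePart Ξ = ξ := planePart_combine ξ ζ
  have hΞ2 : Ξ 2 = ζ := combine_two ξ ζ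
  have hnorm : ‖Ξ‖ = l := by
    have : ‖Ξ‖ ^ 2 = l ^ 2 := by rw [norm_sq_eq_planePart, hΞ, hΞ2, hlξ]
    exact (sq_eq_sq₀ (norm_nonneg _) hl.le).1 this
  have hθ : ‖l⁻¹ • Ξ‖ = 1 := by
    rw [norm_smul, hnorm, norm_inv, Real.norm_of_nonneg hl.le, inv_mul_cancel₀ hl.ne']
  let q : Plane := EuclideanSpace.single i 1
  -- The polarization is the `i`-th unit vector made orthogonal to `Ξ`. The correction is a multiple
  -- of `Ξ`, whose planar part is longitudinal and is annihilated because `J` is divergence free; so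
  -- the transform of `J y i` itself appears.
  let c : ℝ := inner ℝ Ξ (combine q 0) / l ^ 2
  let p : Space := combine q 0 - c • Ξ
  have hp : inner ℝ (l⁻¹ • Ξ) p = 0 := by
    rw [real_inner_smul_left, inner_sub_right, real_inner_smul_right, real_inner_self_eq_norm_sq,
      hnorm, div_mul_cancel₀ _ (by positivity), sub_self, mul_zero]
  have hpp : planePart p = q - c • ξ := by
    have e1 : planePart p = planePart (combine q 0) - c • planePart Ξ := by
      ext j; fin_cases j <;> simp [planePart, p]
    rw [e1, planePart_combine, hΞ]
  have hJc : HasCompactSupport J := HasCompactSupport.of_support_subset_isCompact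
    (isCompact_closedBall (0 : Plane) m)
    ((subset_tsupport J).trans (hJsupp.trans Metric.ball_subset_closedBall))
  have hlap : laplace volume (fun y => inner ℝ (J y) (planePart p)) ξ
      = laplace volume (fun y => J y i) ξ := by
    have hi : ∀ v : Plane, Integrable (fun y => inner ℝ (J y) v * Real.exp (-inner ℝ ξ y))
        volume := fun v => by
      refine Continuous.integrable_of_hasCompactSupport (by fun_prop) ?_
      exact hJc.mono fun y hy h0 => hy (by simp only [h0, inner_zero_left, zero_mul])
    have e1 : ∀ y, inner ℝ (J y) (planePart p) * Real.exp (-inner ℝ ξ y) =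
        inner ℝ (J y) q * Real.exp (-inner ℝ ξ y) -
          c * (inner ℝ (J y) ξ * Real.exp (-inner ℝ ξ y)) := fun y => by
      rw [hpp, inner_sub_right, real_inner_smul_right]; ring
    have e2 := hJdiv.laplace_inner_eq_zero hm hJsupp ξ
    rw [laplace] at e2
    rw [laplace]
    simp only [e1]
    rw [integral_sub (hi q) ((hi ξ).const_mul c), integral_const_mul, e2, mul_zero, sub_zero,
      laplace]
    simp [q, EuclideanSpace.inner_single_right]
  have h0 := hM.integral_planeWave_eq_zero (hT₀.trans_le hTT) hR (fun t ht x hx => by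
      rw [hsa t ht.1 x (hrR'.trans_lt hx), hsb t ht.1 x (hrR'.trans_lt hx), sub_zero])
    hD hφ hφc (by linarith) hφ0 hθ hp
  have hform : ∀ t, 0 < t → ∫ x, φ (t - inner ℝ (l⁻¹ • Ξ) x) *
      inner ℝ (source J h g a t x - source J h g b t x) p =
      laplace volume (fun y => J y i) ξ * laplace volume h ζ *
        ((g t * (Real.exp (-inner ℝ ξ (a t)) - Real.exp (-inner ℝ ξ (b t)))) *
          Real.exp (l * t)) := fun t ht => by
    obtain ⟨i1, e1⟩ := integral_wave_mul_inner_source hl.ne' hJ hh hgT₀ ht (hsa t ht) hφe hθ p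
    obtain ⟨i2, e2⟩ := integral_wave_mul_inner_source hl.ne' hJ hh hgT₀ ht (hsb t ht) hφe hθ p
    simp only [inner_sub_left, mul_sub]
    rw [integral_sub i1 i2, e1, e2, hΞ, hΞ2, hlap]
    ring
  rw [intervalIntegral.integral_of_le (hT₀.le.trans hTT),
    setIntegral_congr_fun measurableSet_Ioc fun t ht => hform t ht.1,
    integral_const_mul] at h0
  rw [intervalIntegral.integral_of_le hT₀.le]
  refine Eq.trans ?_ h0
  congr 1
  symm
  refine setIntegral_eq_of_subset_of_forall_sdiff_eq_zero measurableSet_Ioc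
    (Ioc_subset_Ioc_right hTT) ?_
  intro t ht
  have : T₀ ≤ t := by
    by_contra! h'
    exact ht.2 ⟨ht.1.1, h'.le⟩
  rw [hgT₀ t this, zero_mul, zero_mul]

/-- A continuous, nonzero function of one variable with nonvanishing Laplace transform somewhere
has one which does not vanish, up to a sign of the argument, on an interval of positive numbers. -/
lemma exists_Ioo_laplace_ne_zero (hh : Continuous h) (hc : HasCompactSupport h) (h0 : h ≠ 0) :
    ∃ c d : ℝ, 0 ≤ c ∧ c < d ∧ ∀ s ∈ Ioo c d, ∃ ζ : ℝ, ζ ^ 2 = s ^ 2 ∧ laplace volume h ζ ≠ 0 := by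
  obtain ⟨ζ₀, hζ₀⟩ := exists_laplace_ne_zero (μ := volume) hh hc h0
  have hopen : IsOpen {ζ : ℝ | laplace volume h ζ ≠ 0} :=
    isOpen_ne_fun (continuous_laplace hh hc) continuous_const
  obtain ⟨ε, hε, hb⟩ := Metric.isOpen_iff.1 hopen ζ₀ hζ₀
  refine ⟨|ζ₀|, |ζ₀| + ε, abs_nonneg _, by linarith, fun s hs => ?_⟩
  rcases le_total 0 ζ₀ with h1 | h1
  · rw [abs_of_nonneg h1] at hs
    refine ⟨s, rfl, hb ?_⟩
    rw [Metric.mem_ball, Real.dist_eq, abs_lt]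
    constructor <;> linarith [hs.1, hs.2]
  · rw [abs_of_nonpos h1] at hs
    refine ⟨-s, by ring, hb ?_⟩
    rw [Metric.mem_ball, Real.dist_eq, abs_lt]
    constructor <;> linarith [hs.1, hs.2]

lemma exists_component_ne_zero (hJ : J ∈ admissible) : ∃ i : Fin 2, (fun y => J y i) ≠ 0 := by
  obtain ⟨i, hi⟩ := hJ
  refine ⟨i, fun h0 => ?_⟩
  have h1 := hi (EuclideanSpace.single 0 1) (by simp)
  have h2 : ∀ y, J y i = 0 := fun y => congrFun h0 y
  rw [h2, h2] at h1
  exact lt_irrefl _ h1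

/-- Moving `ξ` a little within `O` in the direction `u - v` isolates `‖u - v‖²`. -/
lemma eq_of_forall_mem_inner_eq {O : Set Plane} (hO : IsOpen O) (hne : O.Nonempty) {u v : Plane}
    (h : ∀ ξ ∈ O, inner ℝ ξ u = inner ℝ ξ v) : u = v := by
  obtain ⟨ξ, hξ⟩ := hne
  have hc : Filter.Tendsto (fun ε : ℝ => ξ + ε • (u - v)) (nhdsWithin 0 (Ioi 0)) (nhds ξ) := by
    have : Continuous fun ε : ℝ => ξ + ε • (u - v) := by fun_prop
    have := (this.tendsto 0).mono_left (nhdsWithin_le_nhds (s := Ioi 0))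
    simpa using this
  obtain ⟨ε, hε, hε0⟩ := ((hc.eventually (hO.mem_nhds hξ)).and self_mem_nhdsWithin).exists
  have h1 := h _ hε
  have h2 := h ξ hξ
  have h3 : inner ℝ (u - v) (u - v) = 0 := by
    rw [inner_add_left, inner_add_left, h2, add_right_inj, ← sub_eq_zero, ← inner_sub_right,
      real_inner_smul_left] at h1
    exact (mul_eq_zero.1 h1).resolve_left (ne_of_gt hε0)
  exact sub_eq_zero.1 (inner_self_eq_zero.1 h3)

end MovingSource

open MovingSource in
theorem theorem4p4
    (Rhat R₁ R T₀ T : ℝ) (hRhat : 0 < Rhat) (hR₁ : 0 < R₁) (hT₀ : 0 < T₀)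
    (hR : Rhat + R₁ < R) (hT : T = T₀ + R + Rhat + R₁)
    -- the profile `J`
    (J : MovingSource.Plane → MovingSource.Plane)
    (hJH : MovingSource.MemH 2 J) (hJcont : Continuous J)
    (hJsupp : tsupport J ⊆ Metric.ball 0 (Rhat * √2 / 2))
    (hJdiv : MovingSource.DivFree J)
    (hJadm : J ∈ MovingSource.admissible)
    -- the factor `h`
    (h : ℝ → ℝ)
    (hhH : MovingSource.MemH 2 h) (hhcont : Continuous h)
    (hhsupp : tsupport h ⊆ Set.Ioo (-(Rhat * √2 / 2)) (Rhat * √2 / 2))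
    (hh0 : h ≠ 0)
    -- the temporal factor `g`
    (g : ℝ → ℝ) (hg : ContDiffOn ℝ 1 g (Set.Ici 0))
    (hg0 : ∀ t ≤ 0, g t = 0) (hgT₀ : ∀ t ≥ T₀, g t = 0)
    (hgsupp : tsupport g = Set.Icc 0 T₀)
    -- two orbits
    (a b : ℝ → MovingSource.Plane)
    (ha : ContDiffOn ℝ 1 a (Set.Icc 0 T₀)) (hb : ContDiffOn ℝ 1 b (Set.Icc 0 T₀))
    (haR₁ : ∀ t ∈ Set.Icc 0 T₀, ‖a t‖ ≤ R₁) (hbR₁ : ∀ t ∈ Set.Icc 0 T₀, ‖b t‖ ≤ R₁)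
    -- the corresponding electric fields
    (E₁ E₂ : ℝ → MovingSource.Space → MovingSource.Space)
    (hE₁ : MovingSource.IsMaxwellSolution T (MovingSource.source J h g a) E₁)
    (hE₂ : MovingSource.IsMaxwellSolution T (MovingSource.source J h g b) E₂)
    -- equal data on the whole sphere
    (hdata : ∀ t ∈ Set.Ioo 0 T, ∀ x ∈ Metric.sphere (0 : MovingSource.Space) R,
      MovingSource.tangentialTrace R (E₁ t) x = MovingSource.tangentialTrace R (E₂ t) x) :
    ∀ t ∈ Set.Icc 0 T₀, a t = b t := by

  have hR0 : 0 < R := by linarith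
  have hTpos : 0 < T := by linarith
  have hm : 0 < Rhat * √2 / 2 := by positivity
  obtain ⟨r, hr, hsrc⟩ := exists_source_radius hRhat hR₁ hJsupp hhsupp hgT₀
  have hsa := hsrc a haR₁
  have hsb := hsrc b hbR₁
  obtain ⟨D, D₁, D₂, C, hM⟩ := hE₁.exists_maxwellCurve hTpos
  obtain ⟨D', D₁', D₂', C', hM'⟩ := hE₂.exists_maxwellCurve hTpos
  have hMs := hM.sub hM'
  have hmem : ∀ a' : ℝ → Plane, ∀ t, (∀ x, r < ‖x‖ → source J h g a' t x = 0) →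
      MemLp (source J h g a' t) 2 volume := fun a' t ht =>
    (continuous_source hJcont hhcont g a' t).memLp_of_hasCompactSupport
      (HasCompactSupport.intro (isCompact_closedBall (0 : Space) r) fun x hx =>
        ht x (by simpa using hx))
  have hext := hMs.ae_eq_zero_exterior hTpos hR0
    (fun t ht => (hmem a t (hsa t ht.1)).sub (hmem b t (hsb t ht.1)))
    (fun t ht x hx => by
      rw [hsa t ht.1 x (by linarith), hsb t ht.1 x (by linarith), sub_zero])
    (fun t ht x hx => covCross_eq_zero_of_crossProduct_eq hR0
      (hdata t ht x (by simpa using hx)))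
  obtain ⟨i, hi⟩ := exists_component_ne_zero hJadm
  have hJc : HasCompactSupport J := HasCompactSupport.of_support_subset_isCompact
    (isCompact_closedBall (0 : Plane) (Rhat * √2 / 2))
    ((subset_tsupport J).trans (hJsupp.trans Metric.ball_subset_closedBall))
  have hJic : Continuous fun y => J y i := by fun_prop
  have hJis : HasCompactSupport fun y => J y i :=
    hJc.mono fun y hy h0 => hy (by simp only [h0, PiLp.zero_apply])
  have hhc : HasCompactSupport h := HasCompactSupport.of_support_subset_isCompact
    (isCompact_Icc (a := -(Rhat * √2 / 2)) (b := Rhat * √2 / 2))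
    ((subset_tsupport h).trans (hhsupp.trans Ioo_subset_Icc_self))
  obtain ⟨c, d, hc0, hcd, hζ⟩ := exists_Ioo_laplace_ne_zero hhcont hhc hh0
  let O : Set Plane := {ξ | laplace volume (fun y => J y i) ξ ≠ 0}
  have hO : IsOpen O := isOpen_ne_fun (continuous_laplace hJic hJis) continuous_const
  have hOne : O.Nonempty := exists_laplace_ne_zero hJic hJis hi
  have hgc : ContinuousOn g (Icc 0 T₀) := hg.continuousOn.mono Icc_subset_Ici_self
  have hG : ∀ ξ ∈ O, ∀ t ∈ Icc 0 T₀,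
      g t * (Real.exp (-inner ℝ ξ (a t)) - Real.exp (-inner ℝ ξ (b t))) = 0 := by
    intro ξ hξ
    have hac := ha.continuousOn
    have hbc := hb.continuousOn
    -- For fixed `ξ` the frequencies `l = √(‖ξ‖² + ζ²)` fill this interval as `|ζ|` runs through
    -- `(c, d)`, where `h` has nonzero transform for one of the two signs of `ζ`.
    have hlt : √(‖ξ‖ ^ 2 + c ^ 2) < √(‖ξ‖ ^ 2 + d ^ 2) :=
      Real.sqrt_lt_sqrt (by positivity) (by nlinarith)
    refine eqOn_zero_of_integral_mul_exp hT₀ (by fun_prop) hlt fun l hl => ?_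
    have hl0 : 0 < l := (Real.sqrt_nonneg _).trans_lt hl.1
    have hl1 := (Real.sqrt_lt' hl0).1 hl.1
    have hl2 := (Real.lt_sqrt hl0.le).1 hl.2
    have hs : 0 ≤ l ^ 2 - ‖ξ‖ ^ 2 := by nlinarith
    obtain ⟨ζ, hζ1, hζ2⟩ := hζ (√(l ^ 2 - ‖ξ‖ ^ 2))
      ⟨Real.lt_sqrt_of_sq_lt (by linarith),
        (Real.sqrt_lt' (by linarith)).2 (by linarith)⟩
    rw [Real.sq_sqrt hs] at hζ1
    -- The length of the observation enters here: `T - R - T₀ = Rhat + R₁ > r`.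
    have := laplace_mul_laplace_mul_integral_eq_zero hl0 hT₀ (by linarith) (by linarith) hR0
      (by linarith) hJcont hhcont hgT₀ hJdiv hm hJsupp hsa hsb hMs hext
      (show ‖ξ‖ ^ 2 + ζ ^ 2 = l ^ 2 by linarith) i
    exact (mul_eq_zero.1 this).resolve_left (mul_ne_zero hξ hζ2)
  have hsupp : Function.support g ⊆ Icc 0 T₀ := hgsupp ▸ subset_tsupport g
  have heq : EqOn a b (Function.support g) := fun t ht => by
    refine eq_of_forall_mem_inner_eq hO hOne fun ξ hξ => ?_
    have h1 := (mul_eq_zero.1 (hG ξ hξ t (hsupp ht))).resolve_left ht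
    exact neg_injective (Real.exp_injective (sub_eq_zero.1 h1))
  -- The times with `g ≠ 0` are dense in `[0, T₀]`, and both orbits are continuous.
  exact heq.of_subset_closure ha.continuousOn hb.continuousOn hsupp hgsupp.ge
end
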